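/- Let $(M,g)$ be a gradient Ricci soliton of dimension $n\ge 1$, that is, a complete smooth $n$-dimensional Riemannian manifold with a smooth function $f:M\to\mathbb R$ and a constant $\mu\in\mathbb R$ such that $$\mathrm R_{ij}+\nabla^2_{ij}f=\frac{\mu}{n}\,g_{ij}.$$ Here the sign of the Riemann tensor is fixed by $\nabla^2_{ij}\omega_k-\nabla^2_{ji}\omega_k=\mathrm R_{ijks}\omega^s$ for 1-forms $\omega$ (where $\nabla^2_{ij}=\nabla_i\nabla_j$), $\mathrm R_{ik}=g^{jl}\mathrm R_{ijkl}$ is the Ricci tensor, $\mathrm R=g^{ij}\mathrm R_{ij}$ the scalar curvature, $\Delta=g^{pq}\nabla_p\nabla_q$ on functions and on tensors, and, for $n\ge 3$, the Weyl tensor $\mathcal W$ is defined by $$\mathrm R_{ijkl}=-\frac{\mathrm R}{(n-1)(n-2)}(g_{ik}g_{jl}-g_{il}g_{jk})+\frac1{n-2}(\mathrm R_{ik}g_{jl}-\mathrm R_{il}g_{jk}+\mathrm R_{jl}g_{ik}-\mathrm R_{jk}g_{il})+\mathcal W_{ijkl}.$$ Then the following formulas hold, at every point and in every smooth chart: 1.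 $\mathrm R+\Delta f=\mu$; 2. $\nabla_i\mathrm R=2\mathrm R_{ij}\nabla^jf$; 3. $\nabla_j\mathrm R_{ik}-\nabla_i\mathrm R_{jk}=\mathrm R_{ijks}\nabla^sf$; 4. $\mathrm R+|\nabla f|^2-\frac{2\mu}{n}f$ is constant on every connected component of $M$ (so it is constant if $M$ is connected); 5. $\Delta\mathrm R=\langle\nabla\mathrm R\,|\,\nabla f\rangle+\frac{2\mu}{n}\mathrm R-2|\mathrm{Ric}|^2$; 6. $\Delta\mathrm R_{ij}=\langle\nabla\mathrm R_{ij}\,|\,\nabla f\rangle+\frac{2\mu}{n}\mathrm R_{ij}-2\mathrm R_{ikjs}\mathrm R^{ks}$; 7. if $n\ge 3$, $$\Delta\mathrm R_{ik}=\langle\nabla\mathrm R_{ik}\,|\,\nabla f\rangle+\frac{2\mu}{n}\mathrm R_{ik}-2\mathcal W_{ijkl}\mathrm R^{jl}+\frac{2}{(n-1)(n-2)}\bigl(\mathrm R^2g_{ik}-n\mathrm R\,\mathrm R_{ik}+2(n-1)\mathrm S_{ik}-(n-1)\mathrm S\,g_{ik}\bigr),$$ where $\mathrm S_{ik}=\mathrm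 R_{ij}g^{jl}\mathrm R_{lk}$ and $\mathrm S=g^{ik}\mathrm S_{ik}$; moreover, in every dimension $n\ge1$, $\mathrm S=|\mathrm{Ric}|^2$. -/

import Mathlib

open Bundle
open scoped Manifold ContDiff

noncomputable section

namespace RicciSoliton

/- Tensor calculus in coordinates. A metric is given by its component functions
`g i j : ℝⁿ → ℝ` in a chart, a covariant tensor field by its component functions. All
definitions below are only evaluated at interior points of the domain of the chart. -/

variable {n : ℕ}

/-- The partial derivative `∂ᵢ u` at `y`. -/
def pd (i : Fin n) (u : EuclideanSpace ℝ (Fin n) → ℝ) (y : EuclideanSpace ℝ (Fin n)) : ℝ :=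
  fderiv ℝ u y (EuclideanSpace.single i 1)

/-- The components `g^{ij}` of the inverse metric. -/
def ginv (g : Fin n → Fin n → EuclideanSpace ℝ (Fin n) → ℝ) (i j : Fin n)
    (y : EuclideanSpace ℝ (Fin n)) : ℝ :=
  (Matrix.of fun a b => g a b y)⁻¹ i j

/-- The Christoffel symbols `Γ^k_{ij} = ½ g^{kl} (∂ᵢ g_{jl} + ∂ⱼ g_{il} - ∂ₗ g_{ij})` of the
Levi-Civita connection. -/
def christoffel (g : Fin n → Fin n → EuclideanSpace ℝ (Fin n) → ℝ) (k i j : Fin n)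
    (y : EuclideanSpace ℝ (Fin n)) : ℝ :=
  (1 / 2) * ∑ l, ginv g k l y * (pd i (g j l) y + pd j (g i l) y - pd l (g i j) y)

/-- `∇ᵢ ω_j = ∂ᵢ ω_j - Γ^m_{ij} ω_m` for a 1-form `ω`. -/
def cov1 (g : Fin n → Fin n → EuclideanSpace ℝ (Fin n) → ℝ)
    (w : Fin n → EuclideanSpace ℝ (Fin n) → ℝ) (i j : Fin n)
    (y : EuclideanSpace ℝ (Fin n)) : ℝ :=
  pd i (w j) y - ∑ m, christoffel g m i j y * w m y

/-- `∇ᵢ T_{jk}` for a covariant 2-tensor `T`. -/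
def cov2 (g : Fin n → Fin n → EuclideanSpace ℝ (Fin n) → ℝ)
    (T : Fin n → Fin n → EuclideanSpace ℝ (Fin n) → ℝ) (i j k : Fin n)
    (y : EuclideanSpace ℝ (Fin n)) : ℝ :=
  pd i (T j k) y - ∑ m, christoffel g m i j y * T m k y - ∑ m, christoffel g m i k y * T j m y

/-- `∇ᵢ T_{jkl}` for a covariant 3-tensor `T`. -/
def cov3 (g : Fin n → Fin n → EuclideanSpace ℝ (Fin n) → ℝ)
    (T : Fin n → Fin n → Fin n → EuclideanSpace ℝ (Fin n) → ℝ) (i j k l : Fin n)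
    (y : EuclideanSpace ℝ (Fin n)) : ℝ :=
  pd i (T j k l) y - ∑ m, christoffel g m i j y * T m k l y
    - ∑ m, christoffel g m i k y * T j m l y - ∑ m, christoffel g m i l y * T j k m y

/-- The Hessian `∇²_{ij} u` of a function. -/
def hess (g : Fin n → Fin n → EuclideanSpace ℝ (Fin n) → ℝ) (u : EuclideanSpace ℝ (Fin n) → ℝ)
    (i j : Fin n) (y : EuclideanSpace ℝ (Fin n)) : ℝ :=
  cov1 g (fun k => pd k u) i j y

/-- The Laplacian `Δ u = g^{ij} ∇²_{ij} u` of a function. -/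
def laplacian (g : Fin n → Fin n → EuclideanSpace ℝ (Fin n) → ℝ)
    (u : EuclideanSpace ℝ (Fin n) → ℝ) (y : EuclideanSpace ℝ (Fin n)) : ℝ :=
  ∑ i, ∑ j, ginv g i j y * hess g u i j y

/-- The components `(Δ T)_{ij} = g^{pq} ∇_p ∇_q T_{ij}` of the (rough) Laplacian of a covariant
2-tensor. -/
def laplacian2 (g : Fin n → Fin n → EuclideanSpace ℝ (Fin n) → ℝ)
    (T : Fin n → Fin n → EuclideanSpace ℝ (Fin n) → ℝ) (i j : Fin n)
    (y : EuclideanSpace ℝ (Fin n)) : ℝ :=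
  ∑ p, ∑ q, ginv g p q y * cov3 g (cov2 g T) p q i j y

/-- The components `∇^i u = g^{ij} ∂ⱼ u` of the gradient of a function. -/
def grad (g : Fin n → Fin n → EuclideanSpace ℝ (Fin n) → ℝ) (u : EuclideanSpace ℝ (Fin n) → ℝ)
    (i : Fin n) (y : EuclideanSpace ℝ (Fin n)) : ℝ :=
  ∑ j, ginv g i j y * pd j u y

/-- The scalar product `⟨∇u, ∇v⟩` of two gradients. -/
def gradInner (g : Fin n → Fin n → EuclideanSpace ℝ (Fin n) → ℝ)
    (u v : EuclideanSpace ℝ (Fin n) → ℝ) (y : EuclideanSpace ℝ (Fin n)) : ℝ :=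
  ∑ i, ∑ j, ginv g i j y * pd i u y * pd j v y

/-- The components `⟨∇T_{ij}, ∇u⟩ = g^{pq} ∇_p T_{ij} ∂_q u`, for a covariant 2-tensor `T`. -/
def gradInner2 (g : Fin n → Fin n → EuclideanSpace ℝ (Fin n) → ℝ)
    (T : Fin n → Fin n → EuclideanSpace ℝ (Fin n) → ℝ) (u : EuclideanSpace ℝ (Fin n) → ℝ)
    (i j : Fin n) (y : EuclideanSpace ℝ (Fin n)) : ℝ :=
  ∑ p, ∑ q, ginv g p q y * cov2 g T p i j y * pd q u y

/-- The components `Rm^s_{ijk}` of the curvature operator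
`(∇ᵢ∇ⱼ - ∇ⱼ∇ᵢ) ∂ₖ = Rm^s_{ijk} ∂ₛ`. -/
def curvOp (g : Fin n → Fin n → EuclideanSpace ℝ (Fin n) → ℝ) (s i j k : Fin n)
    (y : EuclideanSpace ℝ (Fin n)) : ℝ :=
  pd i (christoffel g s j k) y - pd j (christoffel g s i k) y
    + ∑ m, (christoffel g s i m y * christoffel g m j k y
      - christoffel g s j m y * christoffel g m i k y)

/-- The Riemann tensor `R_{ijkl}`, with the sign for which
`∇²_{ij} ω_k - ∇²_{ji} ω_k = R_{ijks} ω^s`, that is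
`R_{ijkl} = - g ((∇ᵢ∇ⱼ - ∇ⱼ∇ᵢ) ∂ₖ, ∂ₗ)`; on the unit sphere it is
`g_{ik} g_{jl} - g_{il} g_{jk}`. -/
def riemann (g : Fin n → Fin n → EuclideanSpace ℝ (Fin n) → ℝ) (i j k l : Fin n)
    (y : EuclideanSpace ℝ (Fin n)) : ℝ :=
  -∑ s, g l s y * curvOp g s i j k y

/-- The Ricci tensor `R_{ik} = g^{jl} R_{ijkl}`. -/
def ricci (g : Fin n → Fin n → EuclideanSpace ℝ (Fin n) → ℝ) (i k : Fin n)
    (y : EuclideanSpace ℝ (Fin n)) : ℝ :=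
  ∑ j, ∑ l, ginv g j l y * riemann g i j k l y

/-- The Ricci tensor with raised indices, `R^{ij} = g^{ia} g^{jb} R_{ab}`. -/
def ricciUp (g : Fin n → Fin n → EuclideanSpace ℝ (Fin n) → ℝ) (i j : Fin n)
    (y : EuclideanSpace ℝ (Fin n)) : ℝ :=
  ∑ a, ∑ b, ginv g i a y * ginv g j b y * ricci g a b y

/-- The scalar curvature `R = g^{ij} R_{ij}`. -/
def scal (g : Fin n → Fin n → EuclideanSpace ℝ (Fin n) → ℝ)
    (y : EuclideanSpace ℝ (Fin n)) : ℝ :=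
  ∑ i, ∑ j, ginv g i j y * ricci g i j y

/-- `|Ric|² = R_{ij} R^{ij}`. -/
def ricciNormSq (g : Fin n → Fin n → EuclideanSpace ℝ (Fin n) → ℝ)
    (y : EuclideanSpace ℝ (Fin n)) : ℝ :=
  ∑ i, ∑ j, ricci g i j y * ricciUp g i j y

/-- The tensor `S_{ik} = R_{ij} g^{jl} R_{lk}`. -/
def ricciSq (g : Fin n → Fin n → EuclideanSpace ℝ (Fin n) → ℝ) (i k : Fin n)
    (y : EuclideanSpace ℝ (Fin n)) : ℝ :=
  ∑ j, ∑ l, ricci g i j y * ginv g j l y * ricci g l k y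

/-- The trace `S = g^{ik} S_{ik}`. -/
def ricciSqTrace (g : Fin n → Fin n → EuclideanSpace ℝ (Fin n) → ℝ)
    (y : EuclideanSpace ℝ (Fin n)) : ℝ :=
  ∑ i, ∑ k, ginv g i k y * ricciSq g i k y

/-- The Weyl tensor, that is the remainder in the decomposition
`R_{ijkl} = - R / ((n-1)(n-2)) (g_{ik} g_{jl} - g_{il} g_{jk})
  + 1 / (n-2) (R_{ik} g_{jl} - R_{il} g_{jk} + R_{jl} g_{ik} - R_{jk} g_{il}) + W_{ijkl}`.
It is meaningful for `n ≥ 3` only. -/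
def weyl (g : Fin n → Fin n → EuclideanSpace ℝ (Fin n) → ℝ) (i j k l : Fin n)
    (y : EuclideanSpace ℝ (Fin n)) : ℝ :=
  riemann g i j k l y
    + scal g y / (((n : ℝ) - 1) * ((n : ℝ) - 2)) * (g i k y * g j l y - g i l y * g j k y)
    - 1 / ((n : ℝ) - 2) * (ricci g i k y * g j l y - ricci g i l y * g j k y
      + ricci g j l y * g i k y - ricci g j k y * g i l y)

end RicciSoliton

namespace RicciSoliton

/-- The components `g_{ij} = ⟨∂ᵢ, ∂ⱼ⟩` of the Riemannian metric in the chart `e`, as functions on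
the target of the chart; `∂ᵢ` is the image of the `i`-th basis vector under the differential of
`e⁻¹`. -/
def metricIn {n : ℕ} {M : Type*} [TopologicalSpace M] [ChartedSpace (EuclideanSpace ℝ (Fin n)) M]
    [RiemannianBundle (fun x : M => TangentSpace (𝓡 n) x)]
    (e : OpenPartialHomeomorph M (EuclideanSpace ℝ (Fin n))) (i j : Fin n)
    (y : EuclideanSpace ℝ (Fin n)) : ℝ :=
  inner ℝ
    (mfderiv (𝓡 n) (𝓡 n) e.symm y (EuclideanSpace.single i (1 : ℝ) : EuclideanSpace ℝ (Fin n)) :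
      TangentSpace (𝓡 n) (e.symm y))
    (mfderiv (𝓡 n) (𝓡 n) e.symm y (EuclideanSpace.single j (1 : ℝ) : EuclideanSpace ℝ (Fin n)) :
      TangentSpace (𝓡 n) (e.symm y))

/-- The `n`-dimensional smooth Riemannian manifold `M` is a gradient Ricci soliton with potential
function `f` and constant `μ`: it is complete, `f` is smooth, and
`R_{ij} + ∇²_{ij} f = (μ / n) g_{ij}` in all smooth charts. -/
structure IsGradientRicciSoliton (n : ℕ) (M : Type*) [EMetricSpace M]
    [ChartedSpace (EuclideanSpace ℝ (Fin n)) M] [IsManifold (𝓡 n) ∞ M]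
    [RiemannianBundle (fun x : M => TangentSpace (𝓡 n) x)]
    [IsContMDiffRiemannianBundle (𝓡 n) ∞ (EuclideanSpace ℝ (Fin n))
      (fun x : M => TangentSpace (𝓡 n) x)]
    [IsRiemannianManifold (𝓡 n) M] (f : M → ℝ) (μ : ℝ) : Prop where
  complete : CompleteSpace M
  smooth : ContMDiff (𝓡 n) 𝓘(ℝ) ∞ f
  equation : ∀ e ∈ IsManifold.maximalAtlas (𝓡 n) ∞ M, ∀ y ∈ e.target, ∀ i j : Fin n,
    ricci (metricIn e) i j y + hess (metricIn e) (f ∘ e.symm) i j y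
      = μ / (n : ℝ) * metricIn e i j y

end RicciSoliton

end

open Bundle
open scoped Manifold ContDiff

noncomputable section

/-! Apart from the constancy statement, everything is local in a chart, and the chart computation
needs only the product rule, commuting partial derivatives and an invertible symmetric matrix. It is
therefore carried out in `MetricCalculus`, over an arbitrary commutative ℝ-algebra, and then
specialised to smooth functions on the target of a chart, so that no differentiability conditions
enter the tensor algebra. Written with the connection matrices `Γ i`, the Ricci identities, the
curvature symmetries and the Bianchi identity become identities in a noncommutative ring.

Put c = μ/n. The trace of Ric + ∇²f = c g gives R + Δf = μ. Since g is parallel, ∇Ric = -∇³f, and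
the Ricci identity for df gives the commutation formula `cov2_Ric_comm`. Its trace, together with 2
div Ric = dR, gives dR = 2 Ric(∇f) (`D_scalar`). Differentiating once more, replacing ∇²f by c g -
Ric and tracing gives ΔR. For ΔRic (`laplacian_Ric`) one takes the divergence of `cov2_Ric_comm`:
the terms in Ric² cancel, and the surplus gradient term vanishes by antisymmetry of the curvature.
The Weyl form is then a substitution.

The differential of R + |∇f|² - 2cf is 2 Ric(∇f) + 2 ∇²f(∇f) - 2c df, which is zero by the soliton
equation contracted with ∇f. To make this a statement on M the quantity must be independent of the
chart. Invariance is proved only for the Laplacian and the gradient norm of f; that of R follows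
from R = μ - Δf. The resulting function is locally constant, hence constant on components. -/

namespace RicciSoliton

/-! ### Connection, curvature and Bianchi identities over an abstract algebra. -/

/-- A commutative algebra with commuting derivations `∂ᵢ` and an invertible symmetric matrix `g`
with inverse `h`: the algebraic setting of tensor calculus in a chart. -/
structure MetricCalculus (ι A : Type*) [Fintype ι] [DecidableEq ι] [CommRing A] [Algebra ℝ A] where
  D : ι → Derivation ℝ A A
  D_comm : ∀ i j a, D i (D j a) = D j (D i a)
  g : Matrix ι ι A
  h : Matrix ι ι A
  g_symm : ∀ i j, g i j = g j i
  g_mul_h : g * h = 1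

namespace MetricCalculus

variable {ι A : Type*} [Fintype ι] [DecidableEq ι] [CommRing A] [Algebra ℝ A]
  (G : MetricCalculus ι A)

lemma g_transpose : G.g.transpose = G.g := by
  ext i j; exact G.g_symm j i

lemma h_mul_g : G.h * G.g = 1 := mul_eq_one_comm.mp G.g_mul_h

lemma h_transpose : G.h.transpose = G.h := by
  have h1 : G.h.transpose * G.g = 1 := by
    rw [← G.g_transpose, ← Matrix.transpose_mul, G.g_mul_h, Matrix.transpose_one]
  calc G.h.transpose = G.h.transpose * (G.g * G.h) := by rw [G.g_mul_h, mul_one]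
    _ = G.h := by rw [← mul_assoc, h1, one_mul]

lemma h_symm (i j : ι) : G.h i j = G.h j i := by
  conv_lhs => rw [← G.h_transpose]
  rfl

lemma sum_h_mul_g (i j : ι) : ∑ k, G.h i k * G.g k j = if i = j then 1 else 0 := by
  rw [← Matrix.mul_apply, G.h_mul_g, Matrix.one_apply]

lemma sum_g_mul_h (i j : ι) : ∑ k, G.g i k * G.h k j = if i = j then 1 else 0 := by
  rw [← Matrix.mul_apply, G.g_mul_h, Matrix.one_apply]

/-- The entrywise derivative of a matrix. -/
def dM (i : ι) (X : Matrix ι ι A) : Matrix ι ι A := X.map (G.D i)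

lemma dM_add (i : ι) (X Y : Matrix ι ι A) : G.dM i (X + Y) = G.dM i X + G.dM i Y := by
  ext; simp [dM]

lemma dM_sub (i : ι) (X Y : Matrix ι ι A) : G.dM i (X - Y) = G.dM i X - G.dM i Y := by
  ext; simp [dM]

lemma dM_smul (i : ι) (c : ℝ) (X : Matrix ι ι A) : G.dM i (c • X) = c • G.dM i X := by
  ext; simp [dM]

lemma dM_mul (i : ι) (X Y : Matrix ι ι A) : G.dM i (X * Y) = G.dM i X * Y + X * G.dM i Y := by
  ext a b
  simp only [dM, Matrix.map_apply, Matrix.mul_apply, Matrix.add_apply, map_sum, Derivation.leibniz,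
    smul_eq_mul, ← Finset.sum_add_distrib]
  exact Finset.sum_congr rfl fun _ _ => by ring

lemma dM_transpose (i : ι) (X : Matrix ι ι A) : G.dM i X.transpose = (G.dM i X).transpose := rfl

lemma dM_comm (i j : ι) (X : Matrix ι ι A) : G.dM i (G.dM j X) = G.dM j (G.dM i X) := by
  ext; simp [dM, G.D_comm i j]

lemma dM_one (i : ι) : G.dM i 1 = 0 := by
  ext a b
  by_cases hab : a = b <;> simp [dM, hab]

/-- The Christoffel symbols. -/
def chr (k i j : ι) : A :=
  (1 / 2 : ℝ) • ∑ l, G.h k l * (G.D i (G.g j l) + G.D j (G.g i l) - G.D l (G.g i j))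

lemma chr_symm (k i j : ι) : G.chr k i j = G.chr k j i := by
  unfold chr
  congr 1
  refine Finset.sum_congr rfl fun l _ => ?_
  rw [G.g_symm i j]; ring

/-- The connection matrices `(Γᵢ)^k_j`. -/
def Γ (i : ι) : Matrix ι ι A := Matrix.of fun k j => G.chr k i j

lemma g_mul_Γ_apply (i j k : ι) : (G.g * G.Γ i) j k
    = (1 / 2 : ℝ) • (G.D i (G.g k j) + G.D k (G.g i j) - G.D j (G.g i k)) := by
  simp only [Matrix.mul_apply, Γ, Matrix.of_apply, chr, mul_smul_comm, ← Finset.smul_sum,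
    Finset.mul_sum]
  rw [Finset.sum_comm]
  simp only [← mul_assoc, ← Finset.sum_mul, sum_g_mul_h, ite_mul, one_mul, zero_mul,
    Finset.sum_ite_eq, Finset.mem_univ, if_true]

/-- Metric compatibility: adding `g Γᵢ` to its transpose cancels the part of the lowered Christoffel
symbols that is antisymmetric in the matrix indices. -/
lemma dM_g (i : ι) : G.dM i G.g = (G.Γ i).transpose * G.g + G.g * G.Γ i := by
  have h1 : (G.Γ i).transpose * G.g = (G.g * G.Γ i).transpose := by
    rw [Matrix.transpose_mul, G.g_transpose]
  ext j k
  rw [h1, Matrix.add_apply, Matrix.transpose_apply, g_mul_Γ_apply, g_mul_Γ_apply, ← smul_add,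
    G.g_symm k j]
  have : G.D i (G.g j k) + G.D j (G.g i k) - G.D k (G.g i j)
      + (G.D i (G.g j k) + G.D k (G.g i j) - G.D j (G.g i k)) = (2 : ℝ) • G.D i (G.g j k) := by
    rw [two_smul]; ring
  rw [this, smul_smul]
  norm_num [dM]

/-- Obtained by differentiating `g * h = 1`, inserting `dM_g` and multiplying by `h` on the left. -/
lemma dM_h (i : ι) : G.dM i G.h = -(G.Γ i * G.h) - G.h * (G.Γ i).transpose := by
  have h1 : G.dM i (G.g * G.h) = 0 := by rw [G.g_mul_h, dM_one]
  rw [dM_mul, dM_g] at h1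
  have h2 := congrArg (G.h * ·) h1
  simp only [mul_add, add_mul, mul_zero] at h2
  have e1 : G.h * ((G.Γ i).transpose * G.g * G.h) = G.h * (G.Γ i).transpose := by
    rw [mul_assoc (G.Γ i).transpose, G.g_mul_h, mul_one]
  have e2 : G.h * (G.g * G.Γ i * G.h) = G.Γ i * G.h := by
    rw [← mul_assoc, ← mul_assoc, G.h_mul_g, one_mul]
  have e3 : G.h * (G.g * G.dM i G.h) = G.dM i G.h := by
    rw [← mul_assoc, G.h_mul_g, one_mul]
  rw [e1, e2, e3] at h2
  rw [eq_comm, ← sub_eq_zero, ← neg_eq_zero, ← h2]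
  abel

/-- Covariant derivative of a 1-form. -/
def cov1 (w : ι → A) (i j : ι) : A := G.D i (w j) - ∑ m, G.chr m i j * w m

/-- Covariant derivative of a covariant 2-tensor. -/
def cov2 (T : ι → ι → A) (i j k : ι) : A :=
  G.D i (T j k) - ∑ m, G.chr m i j * T m k - ∑ m, G.chr m i k * T j m

/-- Covariant derivative of a covariant 3-tensor. -/
def cov3 (T : ι → ι → ι → A) (i j k l : ι) : A :=
  G.D i (T j k l) - ∑ m, G.chr m i j * T m k l
    - ∑ m, G.chr m i k * T j m l - ∑ m, G.chr m i l * T j k m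

/-- Covariant derivative of a covariant 4-tensor. -/
def cov4 (T : ι → ι → ι → ι → A) (q i j k l : ι) : A :=
  G.D q (T i j k l) - ∑ m, G.chr m q i * T m j k l - ∑ m, G.chr m q j * T i m k l
    - ∑ m, G.chr m q k * T i j m l - ∑ m, G.chr m q l * T i j k m

/-- Covariant derivative of a vector field. -/
def covUp (v : ι → A) (i s : ι) : A := G.D i (v s) + ∑ m, G.chr s i m * v m

/-- Matrix form of the covariant derivative of a 2-tensor. -/
def N (i : ι) (X : Matrix ι ι A) : Matrix ι ι A :=
  G.dM i X - (G.Γ i).transpose * X - X * G.Γ i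

lemma cov2_eq (T : ι → ι → A) (i j k : ι) : G.cov2 T i j k = G.N i (Matrix.of T) j k := by
  simp [cov2, N, dM, Γ, Matrix.mul_apply, mul_comm]

lemma N_sub (i : ι) (X Y : Matrix ι ι A) : G.N i (X - Y) = G.N i X - G.N i Y := by
  simp only [N, dM_sub]; noncomm_ring

lemma N_smul (i : ι) (c : ℝ) (X : Matrix ι ι A) : G.N i (c • X) = c • G.N i X := by
  simp only [N, dM_smul, Matrix.mul_smul, Matrix.smul_mul, smul_sub]

lemma N_g (i : ι) : G.N i G.g = 0 := by
  rw [N, dM_g]; abel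

/-- Isolates the first tensor slot and leaves the other two as a matrix. When that slot is a
derivative index, the split-off term drops out of commutators because `chr` is symmetric. -/
lemma cov3_eq (T : ι → ι → ι → A) (i j k l : ι) : G.cov3 T i j k l
    = G.N i (Matrix.of (T j)) k l - ∑ m, G.chr m i j * T m k l := by
  rw [← cov2_eq, cov2, cov3]; ring

/-- The curvature as a matrix-valued 2-form. -/
def F (i j : ι) : Matrix ι ι A :=
  G.dM i (G.Γ j) - G.dM j (G.Γ i) + G.Γ i * G.Γ j - G.Γ j * G.Γ i

lemma F_apply (s i j k : ι) : G.F i j s k = G.D i (G.chr s j k) - G.D j (G.chr s i k)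
    + ∑ m, (G.chr s i m * G.chr m j k - G.chr s j m * G.chr m i k) := by
  simp [F, dM, Γ, Matrix.mul_apply, Finset.sum_sub_distrib]; ring

lemma F_antisymm (i j : ι) : G.F i j = -G.F j i := by
  unfold F; abel

/-- `N i` ignores the derivative index, so its commutator is pure curvature and symmetry of the
Christoffel symbols plays no role: first derivatives of `X` cancel, and the ∂Γ and ΓΓ terms assemble
into `F`. -/
lemma N_comm (i j : ι) (X : Matrix ι ι A) :
    G.N i (G.N j X) - G.N j (G.N i X) = -((G.F i j).transpose * X) - X * G.F i j := by
  simp only [N, F, dM_sub, dM_mul, dM_transpose, Matrix.transpose_sub, Matrix.transpose_add,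
    Matrix.transpose_mul, G.dM_comm j i X]
  noncomm_ring

/-- The Ricci identity for 2-tensors. -/
lemma cov3_cov2_comm (T : ι → ι → A) (i j k l : ι) :
    G.cov3 (G.cov2 T) i j k l - G.cov3 (G.cov2 T) j i k l
      = -((G.F i j).transpose * Matrix.of T) k l - (Matrix.of T * G.F i j) k l := by
  have e : ∀ i, Matrix.of (G.cov2 T i) = G.N i (Matrix.of T) := fun i => by
    ext a b; simp [cov2_eq]
  have := congrFun (congrFun (G.N_comm i j (Matrix.of T)) k) l
  simp only [Matrix.sub_apply, Matrix.neg_apply] at this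
  rw [cov3_eq, cov3_eq, e, e, ← this]
  simp only [G.chr_symm _ j i]
  ring

lemma cov2_cov1_comm (w : ι → A) (i j k : ι) :
    G.cov2 (G.cov1 w) i j k - G.cov2 (G.cov1 w) j i k = -∑ s, G.F i j s k * w s := by
  -- All rows of `W` equal `w`, so `Γ` acts on the 1-form by right multiplication and the
  -- computation again takes place in a matrix ring. Any row carries the answer; the `k`-th one is
  -- read off.
  let W : Matrix ι ι A := Matrix.of fun _ k => w k
  have e : ∀ i a k, G.cov1 w i k = (G.dM i W - W * G.Γ i) a k := fun i a k => by
    simp [cov1, dM, W, Γ, Matrix.mul_apply, mul_comm]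
  have e2 : ∀ i j k, G.cov2 (G.cov1 w) i j k
      = (G.dM i (G.dM j W - W * G.Γ j) - (G.dM j W - W * G.Γ j) * G.Γ i) k k
        - ∑ m, G.chr m i j * G.cov1 w m k := fun i j k => by
    have : ∀ m, G.cov1 w j m * G.Γ i m k = (G.dM j W - W * G.Γ j) k m * G.Γ i m k :=
      fun m => by rw [e j k m]
    rw [Matrix.sub_apply, Matrix.mul_apply, ← Finset.sum_congr rfl fun m _ => this m, dM,
      Matrix.map_apply, ← e, cov2]
    simp only [Γ, Matrix.of_apply, mul_comm]
    ring
  have e3 : G.dM i (G.dM j W - W * G.Γ j) - (G.dM j W - W * G.Γ j) * G.Γ i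
      - (G.dM j (G.dM i W - W * G.Γ i) - (G.dM i W - W * G.Γ i) * G.Γ j) = -(W * G.F i j) := by
    simp only [F, dM_sub, dM_mul, G.dM_comm j i W]
    noncomm_ring
  have e4 := congrFun (congrFun e3 k) k
  simp only [Matrix.sub_apply, Matrix.neg_apply] at e4
  rw [e2, e2]
  have e5 : (W * G.F i j) k k = ∑ s, G.F i j s k * w s := by
    simp [Matrix.mul_apply, W, mul_comm]
  rw [← e5, ← e4]
  simp only [G.chr_symm _ j i, Matrix.sub_apply]
  ring

/-- The Riemann tensor. -/
def riem (i j k l : ι) : A := -∑ s, G.g l s * G.F i j s k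

/-- `N_comm` applied to the parallel matrix `g`: the left side vanishes, which leaves the
antisymmetry of `g F`. -/
lemma F_transpose_mul_g (i j : ι) : (G.F i j).transpose * G.g = -(G.g * G.F i j) := by
  have := G.N_comm i j G.g
  have z : ∀ i, G.N i (0 : Matrix ι ι A) = 0 := fun i => by
    simpa using G.N_smul i 0 0
  rw [N_g, N_g, z, z, sub_zero] at this
  rw [← add_eq_zero_iff_eq_neg, ← neg_eq_zero, neg_add, ← sub_eq_add_neg, ← this]

lemma riem_eq (i j k l : ι) : G.riem i j k l = (G.g * G.F i j) k l := by
  have := congrFun (congrFun (G.F_transpose_mul_g i j) k) l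
  rw [Matrix.neg_apply, ← neg_eq_iff_eq_neg] at this
  rw [← this, riem, Matrix.mul_apply]
  congr 1
  exact Finset.sum_congr rfl fun s _ => by rw [G.g_symm, mul_comm]; rfl

lemma riem_antisymm_left (i j k l : ι) : G.riem i j k l = -G.riem j i k l := by
  rw [riem_eq, riem_eq, F_antisymm, mul_neg]; rfl

lemma riem_antisymm_right (i j k l : ι) : G.riem i j k l = -G.riem i j l k := by
  rw [G.riem_eq i j k l, riem, neg_neg, Matrix.mul_apply]

/-- This is where the first Bianchi identity uses torsion-freeness: once the lower indices of `chr`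
may be exchanged, the terms of the cyclic sum cancel in pairs. -/
lemma F_cyclic (s i j k : ι) : G.F i j s k + G.F j k s i + G.F k i s j = 0 := by
  simp only [F_apply, Finset.sum_sub_distrib]
  simp only [G.chr_symm _ j i, G.chr_symm _ k i, G.chr_symm _ k j]
  ring

lemma riem_cyclic (i j k l : ι) : G.riem i j k l + G.riem j k i l + G.riem k i j l = 0 := by
  have : G.riem i j k l + G.riem j k i l + G.riem k i j l
      = -∑ s, G.g l s * (G.F i j s k + G.F j k s i + G.F k i s j) := by
    simp only [riem, mul_add, Finset.sum_add_distrib]; ring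
  rw [this]; simp [F_cyclic]

/-- A signed sum of the four cyclic identities, reduced by the two antisymmetries, equals twice the
difference of the sides. The factor two is removed by a real scalar. -/
lemma riem_pair_symm (i j k l : ι) : G.riem i j k l = G.riem k l i j := by
  have h1 := G.riem_cyclic i j k l
  have h2 := G.riem_cyclic j k l i
  have h3 := G.riem_cyclic k l i j
  have h4 := G.riem_cyclic l i j k
  have a1 := G.riem_antisymm_right j k i l
  have a2 := G.riem_antisymm_right k l j i
  have a3 := G.riem_antisymm_right l i k j
  have a4 := G.riem_antisymm_right i j l k
  have a7 := G.riem_antisymm_right j l i k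
  have a8 := G.riem_antisymm_right k i j l
  have b7 := G.riem_antisymm_left l j k i
  have b8 := G.riem_antisymm_left i k l j
  have h : (2 : ℝ) • (G.riem i j k l - G.riem k l i j) = 0 := by
    rw [two_smul]
    linear_combination h1 + h2 - h3 - h4 + a4 - a2 - a1 + a3 + b8 - a8 + a7 - b7
  have h' := congrArg ((1 / 2 : ℝ) • ·) h
  simp only [smul_smul, smul_zero] at h'
  norm_num at h'
  exact sub_eq_zero.mp h'

/-- The second Bianchi identity for the curvature form. -/
lemma bianchi_F (i j k : ι) :
    (G.dM i (G.F j k) + G.Γ i * G.F j k - G.F j k * G.Γ i)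
      + (G.dM j (G.F k i) + G.Γ j * G.F k i - G.F k i * G.Γ j)
      + (G.dM k (G.F i j) + G.Γ k * G.F i j - G.F i j * G.Γ k) = 0 := by
  simp only [F, dM_sub, dM_add, dM_mul, G.dM_comm k i, G.dM_comm k j, G.dM_comm j i]
  noncomm_ring

/-- Lowering an index commutes with covariant differentiation because `g` is parallel; this carries
`bianchi_F` over to `riem`. -/
lemma N_g_mul (m : ι) (X : Matrix ι ι A) :
    G.N m (G.g * X) = G.g * (G.dM m X + G.Γ m * X - X * G.Γ m) := by
  rw [N, dM_mul, dM_g]; noncomm_ring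

/-- The second Bianchi identity. -/
lemma bianchi (q i j k l : ι) :
    G.cov4 G.riem q i j k l + G.cov4 G.riem i j q k l + G.cov4 G.riem j q i k l = 0 := by
  have e : ∀ q i j, G.cov4 G.riem q i j k l = G.N q (G.g * G.F i j) k l
      - ∑ m, G.chr m q i * G.riem m j k l - ∑ m, G.chr m q j * G.riem i m k l := fun q i j => by
    have : G.g * G.F i j = Matrix.of (G.riem i j) := by
      ext a b; rw [Matrix.of_apply, riem_eq]
    rw [this, ← cov2_eq, cov2, cov4]; ring
  have b0 := congrArg (G.g * ·) (G.bianchi_F q i j)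
  beta_reduce at b0
  rw [mul_zero, mul_add, mul_add, ← N_g_mul, ← N_g_mul, ← N_g_mul] at b0
  have b := congrFun (congrFun b0 k) l
  simp only [Matrix.add_apply, Matrix.zero_apply] at b
  rw [e, e, e]
  -- The Christoffel terms acting on the cyclically permuted indices cancel, by symmetry of `chr`
  -- and antisymmetry of `riem`.
  simp only [G.riem_antisymm_left i _ k l, G.riem_antisymm_left j _ k l,
    G.riem_antisymm_left q _ k l, G.chr_symm _ i q, G.chr_symm _ j q, G.chr_symm _ j i,
    mul_neg, Finset.sum_neg_distrib]
  linear_combination b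

end MetricCalculus
end RicciSoliton

/-! ### Traces, Ricci curvature and the contracted Bianchi identities. -/

namespace RicciSoliton
namespace MetricCalculus

variable {ι A : Type*} [Fintype ι] [DecidableEq ι] [CommRing A] [Algebra ℝ A]
  (G : MetricCalculus ι A)

/-- The trace `h^{ab} T_{ab}` of a 2-tensor. -/
def con : (ι → ι → A) →ₗ[A] A where
  toFun T := ∑ a, ∑ b, G.h a b * T a b
  map_add' S T := by simp [mul_add, Finset.sum_add_distrib]
  map_smul' c T := by
    simp only [Pi.smul_apply, smul_eq_mul, RingHom.id_apply, Finset.mul_sum]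
    exact Finset.sum_congr rfl fun _ _ => Finset.sum_congr rfl fun _ _ => by ring

lemma con_apply (T : ι → ι → A) : G.con T = ∑ a, ∑ b, G.h a b * T a b := rfl

lemma con_eq_trace (T : ι → ι → A) : G.con T = (G.h * Matrix.of T).trace := by
  rw [con_apply, Finset.sum_comm, Matrix.trace]
  simp only [Matrix.diag_apply, Matrix.mul_apply, Matrix.of_apply]
  exact Finset.sum_congr rfl fun _ _ => Finset.sum_congr rfl fun _ _ => by rw [G.h_symm]

lemma con_swap (T : ι → ι → A) : G.con (fun a b => T b a) = G.con T := by
  rw [con_apply, Finset.sum_comm, con_apply]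
  exact Finset.sum_congr rfl fun _ _ => Finset.sum_congr rfl fun _ _ => by rw [G.h_symm]

lemma con_add (S T : ι → ι → A) : G.con (fun a b => S a b + T a b) = G.con S + G.con T :=
  map_add G.con S T

lemma con_sub (S T : ι → ι → A) : G.con (fun a b => S a b - T a b) = G.con S - G.con T :=
  map_sub G.con S T

lemma con_neg (T : ι → ι → A) : G.con (fun a b => -T a b) = -G.con T :=
  map_neg G.con T

lemma con_mul_left (c : A) (T : ι → ι → A) : G.con (fun a b => c * T a b) = c * G.con T :=
  map_smul G.con c T

lemma con_mul_right (c : A) (T : ι → ι → A) : G.con (fun a b => T a b * c) = G.con T * c := by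
  simp only [mul_comm _ c, con_mul_left]

lemma con_smul (c : ℝ) (T : ι → ι → A) : G.con (fun a b => c • T a b) = c • G.con T := by
  simp only [← algebraMap_smul A c, smul_eq_mul, con_mul_left]

lemma con_sum (T : ι → ι → ι → A) :
    G.con (fun a b => ∑ m, T m a b) = ∑ m, G.con (T m) := by
  rw [← map_sum]; congr 1; ext a b; simp

lemma con_con_comm (T : ι → ι → ι → ι → A) :
    G.con (fun a b => G.con fun c d => T a b c d) = G.con fun c d => G.con fun a b => T a b c d := by
  calc G.con (fun a b => G.con fun c d => T a b c d)
      = ∑ a, ∑ b, G.con (fun c d => G.h a b * T a b c d) := by simp only [con_mul_left]; rfl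
    _ = G.con (fun c d => ∑ a, ∑ b, G.h a b * T a b c d) := by simp only [con_sum]

lemma con_g : G.con (fun i j => G.g i j) = Fintype.card ι := by
  rw [con_eq_trace, show Matrix.of (fun i j => G.g i j) = G.g from rfl, G.h_mul_g,
    Matrix.trace_one]

/-- The inverse metric is parallel: after inserting `dM_h`, the connection terms left over form a
commutator, whose trace is zero. -/
lemma D_con (i : ι) (T : ι → ι → A) : G.D i (G.con T) = G.con (G.cov2 T i) := by
  have h1 : G.D i (G.con T) = (G.dM i (G.h * Matrix.of T)).trace := by
    rw [con_eq_trace]; simp [Matrix.trace, dM]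
  have h2 : Matrix.of (G.cov2 T i) = G.N i (Matrix.of T) := by ext a b; simp [cov2_eq]
  rw [h1, con_eq_trace, h2, N, dM_mul, dM_h]
  have h3 := Matrix.trace_mul_comm (G.Γ i) (G.h * Matrix.of T)
  have h4 : (-(G.Γ i * G.h) - G.h * (G.Γ i).transpose) * Matrix.of T + G.h * G.dM i (Matrix.of T)
      = G.h * (G.dM i (Matrix.of T) - (G.Γ i).transpose * Matrix.of T - Matrix.of T * G.Γ i)
        + (G.h * Matrix.of T * G.Γ i - G.Γ i * (G.h * Matrix.of T)) := by noncomm_ring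
  rw [h4, Matrix.trace_add, Matrix.trace_sub, ← h3, sub_self, add_zero]

lemma con_cov3 (T : ι → ι → ι → A) (i j : ι) :
    G.con (fun a b => G.cov3 T i a b j) = G.cov1 (fun j => G.con fun a b => T a b j) i j := by
  simp only [cov1, D_con, ← con_mul_left, ← con_sum, ← con_sub]
  congr 1

lemma con_cov4 (T : ι → ι → ι → ι → A) (q i k : ι) :
    G.con (fun a b => G.cov4 T q i a k b)
      = G.cov2 (fun i k => G.con fun a b => T i a k b) q i k := by
  simp only [cov2, D_con, ← con_mul_left, ← con_sum, ← con_sub]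
  congr 1; ext a b
  simp only [cov4]; ring

/-- The Ricci tensor. -/
def Ric (i k : ι) : A := G.con fun j l => G.riem i j k l

/-- The scalar curvature. -/
def scalar : A := G.con G.Ric

lemma Ric_symm (i k : ι) : G.Ric i k = G.Ric k i := by
  rw [Ric, Ric, ← con_swap]
  simp only [G.riem_pair_symm i _ k]

/-- The Hessian of a function. -/
def Hess (u : A) : ι → ι → A := G.cov1 fun k => G.D k u

/-- The gradient of a function. -/
def gradient (u : A) (s : ι) : A := ∑ t, G.h s t * G.D t u

lemma sum_mul_gradient (X : ι → A) (u : A) :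
    ∑ s, X s * G.gradient u s = G.con fun s t => X s * G.D t u := by
  simp only [gradient, con_apply, Finset.mul_sum]
  exact Finset.sum_congr rfl fun _ _ => Finset.sum_congr rfl fun _ _ => by ring

lemma sum_g_mul_gradient (u : A) (s : ι) : ∑ t, G.g s t * G.gradient u t = G.D s u := by
  simp only [gradient, Finset.mul_sum]
  rw [Finset.sum_comm]
  simp only [← mul_assoc, ← Finset.sum_mul, sum_g_mul_h, ite_mul, one_mul, zero_mul,
    Finset.sum_ite_eq, Finset.mem_univ, if_true]

/-- Of the two Christoffel terms in the derivative of `h`, one cancels the connection term of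
`covUp` and the other completes the second derivative of `u` to the Hessian. -/
lemma covUp_gradient (u : A) (i s : ι) :
    G.covUp (G.gradient u) i s = ∑ t, G.h s t * G.Hess u i t := by
  have hD : ∀ a b, G.D i (G.h a b)
      = -(∑ m, G.chr a i m * G.h m b) - ∑ m, G.h a m * G.chr b i m := fun a b => by
    have := congrFun (congrFun (G.dM_h i) a) b
    simpa [dM, Matrix.mul_apply, Γ] using this
  simp only [covUp, gradient, map_sum, Derivation.leibniz, smul_eq_mul, hD, Hess, cov1, mul_sub,
    Finset.sum_sub_distrib, Finset.sum_add_distrib, mul_neg, Finset.sum_neg_distrib,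
    Finset.mul_sum]
  have e1 : ∑ x, ∑ m, G.D x u * (G.chr s i m * G.h m x)
      = ∑ m, ∑ x, G.chr s i m * (G.h m x * G.D x u) := by
    rw [Finset.sum_comm]
    exact Finset.sum_congr rfl fun _ _ => Finset.sum_congr rfl fun _ _ => by ring
  have e2 : ∑ x, ∑ m, G.D x u * (G.h s m * G.chr x i m)
      = ∑ m, ∑ x, G.h s m * (G.chr x i m * G.D x u) := by
    rw [Finset.sum_comm]
    exact Finset.sum_congr rfl fun _ _ => Finset.sum_congr rfl fun _ _ => by ring
  rw [e1, e2]; ring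

lemma D_sum_mul (i : ι) (X v : ι → A) :
    G.D i (∑ s, X s * v s) = ∑ s, G.cov1 X i s * v s + ∑ s, X s * G.covUp v i s := by
  have e : ∑ s, (∑ m, G.chr m i s * X m) * v s = ∑ s, X s * ∑ m, G.chr s i m * v m := by
    simp only [Finset.sum_mul, Finset.mul_sum]
    rw [Finset.sum_comm]
    exact Finset.sum_congr rfl fun _ _ => Finset.sum_congr rfl fun _ _ => by ring
  simp only [map_sum, Derivation.leibniz, smul_eq_mul, cov1, covUp, sub_mul, mul_add,
    Finset.sum_add_distrib, Finset.sum_sub_distrib, e]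
  simp only [mul_comm (v _)]
  ring

lemma cov1_sum_mul (T : ι → ι → A) (v : ι → A) (i j : ι) :
    G.cov1 (fun j => ∑ s, T j s * v s) i j
      = ∑ s, G.cov2 T i j s * v s + ∑ s, T j s * G.covUp v i s := by
  have e : ∑ m, G.chr m i j * ∑ s, T m s * v s = ∑ s, (∑ m, G.chr m i j * T m s) * v s := by
    simp only [Finset.sum_mul, Finset.mul_sum]
    rw [Finset.sum_comm]
    simp only [mul_assoc]
  rw [cov1, D_sum_mul, e]
  simp only [cov1, cov2, sub_mul, Finset.sum_sub_distrib]
  ring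

lemma cov3_sum_mul (T : ι → ι → ι → ι → A) (v : ι → A) (q i j k : ι) :
    G.cov3 (fun i j k => ∑ s, T i j k s * v s) q i j k
      = ∑ s, G.cov4 T q i j k s * v s + ∑ s, T i j k s * G.covUp v q s := by
  have e : ∀ (c : ι → A) (S : ι → ι → A),
      ∑ m, c m * ∑ s, S m s * v s = ∑ s, (∑ m, c m * S m s) * v s := fun c S => by
    simp only [Finset.sum_mul, Finset.mul_sum]
    rw [Finset.sum_comm]
    simp only [mul_assoc]
  rw [cov3, D_sum_mul, e, e, e]
  simp only [cov1, cov4, sub_mul, Finset.sum_sub_distrib]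
  ring

lemma cov3_add (S T : ι → ι → ι → A) (q i j k : ι) :
    G.cov3 (fun i j k => S i j k + T i j k) q i j k = G.cov3 S q i j k + G.cov3 T q i j k := by
  simp only [cov3, map_add, mul_add, Finset.sum_add_distrib]; ring

lemma cov3_swap (T : ι → ι → ι → A) (q i j k : ι) :
    G.cov3 (fun i j k => T j i k) q i j k = G.cov3 T q j i k := by
  simp only [cov3]; ring

lemma cov4_riem_antisymm_left (q i j k l : ι) :
    G.cov4 G.riem q i j k l = -G.cov4 G.riem q j i k l := by
  have e : G.riem = fun i j k l => -G.riem j i k l := by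
    ext i j k l; exact G.riem_antisymm_left i j k l
  conv_lhs => rw [e]
  simp only [cov4, map_neg, mul_neg, Finset.sum_neg_distrib]; ring

lemma cov4_riem_pair_symm (q i j k l : ι) :
    G.cov4 G.riem q i j k l = G.cov4 G.riem q k l i j := by
  have e : G.riem = fun i j k l => G.riem k l i j := by
    ext i j k l; exact G.riem_pair_symm i j k l
  conv_lhs => rw [e]
  simp only [cov4]; ring

lemma cov2_Ric_symm (q i k : ι) : G.cov2 G.Ric q i k = G.cov2 G.Ric q k i := by
  have e : G.Ric = fun i k => G.Ric k i := by ext i k; exact G.Ric_symm i k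
  conv_lhs => rw [e]
  simp only [cov2]; ring

lemma con_cov4_riem (q i k : ι) :
    G.con (fun a b => G.cov4 G.riem q i a k b) = G.cov2 G.Ric q i k := G.con_cov4 G.riem q i k

/-- The contracted second Bianchi identity. -/
lemma div_riem (i j s : ι) : G.con (fun p l => G.cov4 G.riem p i l j s)
    = G.cov2 G.Ric s i j - G.cov2 G.Ric j i s := by
  -- Pair symmetry brings `p, j, s` into the cyclic triple of the Bianchi identity, with `i, l` as
  -- the fixed pair; tracing the other two terms over `p, l` then gives derivatives of `Ric`.
  have h1 : ∀ p l, G.cov4 G.riem p i l j s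
      = G.cov4 G.riem s j p i l - G.cov4 G.riem j s p i l := fun p l => by
    have := G.bianchi p j s i l
    rw [G.cov4_riem_pair_symm p i l, eq_sub_iff_add_eq]
    rw [G.cov4_riem_antisymm_left s j p]
    linear_combination this
  simp only [h1, con_sub, con_cov4_riem, G.cov2_Ric_symm _ i]

/-- The twice contracted second Bianchi identity. -/
lemma two_div_Ric (j : ι) :
    2 * G.con (fun p q => G.cov2 G.Ric p q j) = G.D j G.scalar := by
  -- Trace `div_riem` once more, over `i, s`. After the two traces are exchanged the left side is
  -- minus the divergence of `Ric`, so the divergence occurs twice.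
  have h1 : G.con (fun i s => G.con fun p l => G.cov4 G.riem p i l j s)
      = G.con (fun i s => G.cov2 G.Ric s i j) - G.con (fun i s => G.cov2 G.Ric j i s) := by
    simp only [div_riem, con_sub]
  have h2 : ∀ p l, G.con (fun i s => G.cov4 G.riem p i l j s) = -G.cov2 G.Ric p l j := fun p l => by
    rw [← con_cov4_riem, ← con_neg]
    simp only [← G.cov4_riem_antisymm_left]
  rw [con_con_comm] at h1
  simp only [h2, con_neg] at h1
  have h3 : G.con (fun i s => G.cov2 G.Ric s i j) = G.con (fun p q => G.cov2 G.Ric p q j) :=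
    G.con_swap fun p q => G.cov2 G.Ric p q j
  have h4 : G.con (fun i s => G.cov2 G.Ric j i s) = G.D j G.scalar := (G.D_con j G.Ric).symm
  rw [h3, h4] at h1
  linear_combination -h1

/-- The Ricci tensor with raised indices. -/
def RicUp (i j : ι) : A := ∑ a, ∑ b, G.h i a * G.h j b * G.Ric a b

/-- The square of the Ricci tensor. -/
def RicSq (i k : ι) : A := ∑ j, ∑ l, G.Ric i j * G.h j l * G.Ric l k

/-- The squared norm of the Ricci tensor. -/
def RicNormSq : A := ∑ i, ∑ j, G.Ric i j * G.RicUp i j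

lemma RicUp_symm (i j : ι) : G.RicUp i j = G.RicUp j i := by
  rw [RicUp, Finset.sum_comm, RicUp]
  exact Finset.sum_congr rfl fun a _ => Finset.sum_congr rfl fun b _ => by
    rw [G.Ric_symm]; ring

lemma con_RicSq : G.con G.RicSq = G.RicNormSq := by
  rw [con_apply, RicNormSq]
  refine Finset.sum_congr rfl fun i _ => ?_
  simp only [RicSq, RicUp, Finset.mul_sum]
  rw [Finset.sum_comm]
  refine Finset.sum_congr rfl fun j _ => Finset.sum_congr rfl fun k _ =>
    Finset.sum_congr rfl fun l _ => ?_
  rw [G.Ric_symm l k]; ring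

lemma F_eq_riem (i j s k : ι) : G.F i j s k = -∑ t, G.h s t * G.riem i j k t := by
  have e : ∀ t, G.riem i j k t = -(G.g * G.F i j) t k := fun t => by
    rw [riem, Matrix.mul_apply]
  simp only [e, mul_neg, Finset.sum_neg_distrib, neg_neg]
  rw [← Matrix.mul_apply, ← mul_assoc, G.h_mul_g, one_mul]

/-- The Ricci identity for gradients. -/
lemma cov2_Hess_comm (u : A) (i j k : ι) : G.cov2 (G.Hess u) i j k - G.cov2 (G.Hess u) j i k
    = ∑ s, G.riem i j k s * G.gradient u s := by
  rw [Hess, cov2_cov1_comm, ← Finset.sum_neg_distrib]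
  simp only [F_eq_riem, neg_mul, neg_neg, gradient, Finset.sum_mul, Finset.mul_sum]
  rw [Finset.sum_comm]
  refine Finset.sum_congr rfl fun s _ => Finset.sum_congr rfl fun t _ => ?_
  rw [G.h_symm]; ring

lemma con_riem_right (i j : ι) : G.con (fun p q => G.riem p i q j) = G.Ric i j := by
  rw [Ric]
  congr 1; ext p q
  rw [G.riem_antisymm_left, G.riem_antisymm_right, neg_neg]

lemma con_sum_mul_Ric (Y : ι → ι → A) :
    G.con (fun p q => ∑ t, ∑ s, Y p t * G.h t s * G.Ric q s)
      = ∑ p, ∑ t, Y p t * G.RicUp p t := by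
  simp only [con_apply, RicUp, Finset.mul_sum]
  refine Finset.sum_congr rfl fun p _ => ?_
  rw [Finset.sum_comm]
  exact Finset.sum_congr rfl fun _ _ => Finset.sum_congr rfl fun _ _ =>
    Finset.sum_congr rfl fun _ _ => by ring

lemma eq_zero_of_two_mul_eq_zero {a : A} (h : 2 * a = 0) : a = 0 := by
  have := congrArg ((1 / 2 : ℝ) • ·) h
  simpa [two_mul, ← two_smul ℝ, smul_smul] using this

/-- The contraction of the commutator of covariant derivatives on the Ricci tensor. -/
lemma con_cov3_cov2_Ric (i j : ι) : G.con (fun p q => G.cov3 (G.cov2 G.Ric) p i q j)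
    = G.con (fun p q => G.cov3 (G.cov2 G.Ric) i p q j) + G.RicSq i j
      - ∑ k, ∑ s, G.riem i k j s * G.RicUp k s := by
  -- Curvature acting on the slot `q` is traced to a Ricci tensor and produces `RicSq`; acting on
  -- the slot `j`, treated in `h2`, it stays a full Riemann tensor contracted with `RicUp`.
  have h1 : ∀ p q, -((G.F p i).transpose * Matrix.of G.Ric) q j
      = ∑ s, (∑ t, G.riem p i q t * G.h s t) * G.Ric s j := fun p q => by
    simp only [Matrix.mul_apply, Matrix.transpose_apply, Matrix.of_apply, F_eq_riem, neg_mul,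
      Finset.sum_neg_distrib, neg_neg]
    simp only [mul_comm]
  have h2 : ∀ p q, (Matrix.of G.Ric * G.F p i) q j
      = ∑ t, ∑ s, G.riem i p j t * G.h t s * G.Ric q s := fun p q => by
    simp only [Matrix.mul_apply, Matrix.of_apply, F_eq_riem, ← Finset.sum_neg_distrib,
      Finset.mul_sum]
    rw [Finset.sum_comm]
    refine Finset.sum_congr rfl fun s _ => Finset.sum_congr rfl fun t _ => ?_
    rw [G.riem_antisymm_left, G.h_symm]; ring
  have h3 : ∀ p q, G.cov3 (G.cov2 G.Ric) p i q j = G.cov3 (G.cov2 G.Ric) i p q j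
      + ∑ s, (∑ t, G.riem p i q t * G.h s t) * G.Ric s j
      - ∑ t, ∑ s, G.riem i p j t * G.h t s * G.Ric q s := fun p q => by
    rw [← h1, ← h2]
    linear_combination G.cov3_cov2_comm G.Ric p i q j
  simp only [h3, con_sub, con_add]
  rw [G.con_sum_mul_Ric fun p t => G.riem i p j t]
  simp only [con_sum, con_mul_right, con_riem_right]
  congr 2
  simp only [RicSq, Finset.sum_mul]
  rw [Finset.sum_comm]
  exact Finset.sum_congr rfl fun _ _ => Finset.sum_congr rfl fun _ _ => by rw [G.h_symm]

/-! ### Consequences of the soliton equation. -/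

section Soliton

variable {G} {f : A} {c : ℝ}

lemma scalar_add_con_Hess (hS : ∀ i j, G.Ric i j + G.Hess f i j = c • G.g i j)
    : G.scalar + G.con (G.Hess f) = c • (Fintype.card ι : A) := by
  rw [← G.con_g, ← con_smul, scalar, ← map_add]
  congr 1; ext i j
  exact hS i j

/-- The term `c • g` disappears because the metric is parallel and `c` is a real constant. -/
lemma cov2_Ric_eq (hS : ∀ i j, G.Ric i j + G.Hess f i j = c • G.g i j)
    (i j k : ι) : G.cov2 G.Ric i j k = -G.cov2 (G.Hess f) i j k := by
  have e : Matrix.of G.Ric = c • G.g - Matrix.of (G.Hess f) := by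
    ext a b; simp [← hS a b]
  rw [cov2_eq, cov2_eq, e, N_sub, N_smul, N_g, smul_zero, zero_sub]; rfl

lemma cov2_Ric_comm (hS : ∀ i j, G.Ric i j + G.Hess f i j = c • G.g i j)
    (i j k : ι) : G.cov2 G.Ric j i k - G.cov2 G.Ric i j k
    = ∑ s, G.riem i j k s * G.gradient f s := by
  rw [cov2_Ric_eq hS, cov2_Ric_eq hS, ← cov2_Hess_comm]; ring

/-- The trace of `cov2_Ric_comm` over `j, k` reads div Ric - dR = -Ric(∇f), and `two_div_Ric` turns
div Ric into dR/2. -/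
lemma D_scalar (hS : ∀ i j, G.Ric i j + G.Hess f i j = c • G.g i j)
    (i : ι) : G.D i G.scalar = 2 * ∑ j, G.Ric i j * G.gradient f j := by
  have h1 : G.con (fun j k => G.cov2 G.Ric j i k) - G.con (fun j k => G.cov2 G.Ric i j k)
      = -∑ s, G.Ric i s * G.gradient f s := by
    rw [← con_sub]
    simp only [cov2_Ric_comm hS, con_sum, con_mul_right, ← Finset.sum_neg_distrib, ← neg_mul]
    refine Finset.sum_congr rfl fun s _ => ?_
    rw [Ric, ← con_neg]
    simp only [← G.riem_antisymm_right]
  have h2 : G.con (fun j k => G.cov2 G.Ric i j k) = G.D i G.scalar := (G.D_con i G.Ric).symm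
  have h3 := G.two_div_Ric i
  simp only [G.cov2_Ric_symm _ _ i] at h3
  rw [h2] at h1
  linear_combination -2 * h1 + h3

/-- The soliton equation as a substitution rule: the derivative of the gradient of `f` is `c` times
the identity minus the Ricci endomorphism. -/
lemma sum_mul_covUp (hS : ∀ i j, G.Ric i j + G.Hess f i j = c • G.g i j)
    (X : ι → A) (i : ι) : ∑ s, X s * G.covUp (G.gradient f) i s
    = c • X i - ∑ s, ∑ t, X s * G.h s t * G.Ric t i := by
  have e : ∀ t, G.Hess f i t = c • G.g t i - G.Ric t i := fun t => by
    rw [G.g_symm, ← hS, G.Ric_symm t]; ring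
  have e2 : ∑ s, X s * ∑ t, G.h s t * (c • G.g t i) = c • X i := by
    simp only [mul_smul_comm, ← Finset.smul_sum, sum_h_mul_g]
    simp
  rw [← e2]
  simp only [covUp_gradient, e, mul_sub, Finset.sum_sub_distrib, Finset.mul_sum, mul_assoc]

/-- Product rule applied to `D_scalar`, with the derivative of the gradient eliminated by
`sum_mul_covUp`. -/
lemma Hess_scalar (hS : ∀ i j, G.Ric i j + G.Hess f i j = c • G.g i j)
    (i j : ι) : G.Hess G.scalar i j
    = 2 * (∑ s, G.cov2 G.Ric i j s * G.gradient f s + c • G.Ric i j - G.RicSq i j) := by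
  have e : (fun k => G.D k G.scalar) = fun k => ∑ s, (2 * G.Ric k s) * G.gradient f s := by
    ext k; rw [D_scalar hS, Finset.mul_sum]; simp only [mul_assoc]
  have e2 : ∀ s, G.cov2 (fun k s => 2 * G.Ric k s) i j s = 2 * G.cov2 G.Ric i j s := fun s => by
    simp only [cov2, two_mul, map_add, mul_add, Finset.sum_add_distrib]; ring
  have e3 : G.RicSq i j = ∑ s, ∑ t, G.Ric j s * G.h s t * G.Ric t i := by
    rw [RicSq, Finset.sum_comm]
    refine Finset.sum_congr rfl fun _ _ => Finset.sum_congr rfl fun _ _ => ?_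
    rw [G.Ric_symm i, G.h_symm, G.Ric_symm j]; ring
  rw [Hess, e, cov1_sum_mul, sum_mul_covUp hS]
  simp only [e2, e3, G.Ric_symm i j, mul_assoc, mul_add, mul_sub, Finset.mul_sum, mul_smul_comm]
  ring

/-- Trace of `Hess_scalar`. The gradient term comes from `two_div_Ric`, which identifies twice the
traced derivative of `Ric` with dR. -/
lemma con_Hess_scalar (hS : ∀ i j, G.Ric i j + G.Hess f i j = c • G.g i j)
    : G.con (G.Hess G.scalar)
    = G.con (fun s t => G.D s G.scalar * G.D t f) + (2 * c) • G.scalar - 2 * G.RicNormSq := by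
  have e : G.Hess G.scalar = fun i j =>
      2 * (∑ s, G.cov2 G.Ric i j s * G.gradient f s + c • G.Ric i j - G.RicSq i j) := by
    ext i j; exact Hess_scalar hS i j
  rw [e, ← sum_mul_gradient]
  simp only [con_mul_left, con_sub, con_add, con_sum, con_mul_right, con_smul, ← two_div_Ric,
    con_RicSq, mul_assoc, ← Finset.mul_sum]
  rw [mul_smul, two_smul, scalar]; ring

/-- The Laplacian of the Ricci tensor. -/
lemma laplacian_Ric (hS : ∀ i j, G.Ric i j + G.Hess f i j = c • G.g i j)
    (i j : ι) : G.con (fun p q => G.cov3 (G.cov2 G.Ric) p q i j)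
    = G.con (fun p q => G.cov2 G.Ric p i j * G.D q f) + (2 * c) • G.Ric i j
      - 2 * ∑ k, ∑ s, G.riem i k j s * G.RicUp k s := by
  set Q := ∑ k, ∑ s, G.riem i k j s * G.RicUp k s with hQ
  -- Exchanging `q` and `i` before differentiating exposes a divergence of `Ric`, at the cost of a
  -- curvature term in the gradient of `f`.
  have h1 : G.cov2 G.Ric = fun q i j =>
      G.cov2 G.Ric i q j + ∑ s, G.riem i q j s * G.gradient f s := by
    ext q i j; rw [← cov2_Ric_comm hS]; ring
  have h2 : ∀ p q, G.cov3 (G.cov2 G.Ric) p q i j = G.cov3 (G.cov2 G.Ric) p i q j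
      + (∑ s, G.cov4 G.riem p i q j s * G.gradient f s
        + ∑ s, G.riem i q j s * G.covUp (G.gradient f) p s) := fun p q => by
    conv_lhs => rw [h1]
    rw [cov3_add, ← cov3_sum_mul, cov3_swap,
      G.cov3_swap fun i q j => ∑ s, G.riem i q j s * G.gradient f s]
  -- The derivative of the divergence of `Ric` is half the Hessian of the scalar curvature, known
  -- from `Hess_scalar`. Its `-RicSq` cancels the `+RicSq` in `con_cov3_cov2_Ric`.
  have h3 : G.con (fun p q => G.cov3 (G.cov2 G.Ric) i p q j)
      = ∑ s, G.cov2 G.Ric i j s * G.gradient f s + c • G.Ric i j - G.RicSq i j := by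
    have : G.Hess G.scalar i j = 2 * G.con (fun p q => G.cov3 (G.cov2 G.Ric) i p q j) := by
      rw [con_cov3, Hess]
      simp only [← two_div_Ric, cov1, two_mul, map_add, mul_add, Finset.sum_add_distrib]
      ring
    rw [Hess_scalar hS] at this
    rw [← sub_eq_zero]
    apply eq_zero_of_two_mul_eq_zero
    linear_combination -this
  have h4 : G.con (fun p q => ∑ s, G.riem i q j s * G.covUp (G.gradient f) p s)
      = c • G.Ric i j - Q := by
    simp only [sum_mul_covUp hS, con_sub, con_smul]
    rw [G.con_swap fun q p => G.riem i q j p,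
      G.con_swap fun q p => ∑ s, ∑ t, G.riem i q j s * G.h s t * G.Ric t p]
    simp only [fun t p => G.Ric_symm t p]
    rw [G.con_sum_mul_Ric fun q s => G.riem i q j s]
    rfl
  have h5 : G.con (fun p q => ∑ s, G.cov4 G.riem p i q j s * G.gradient f s)
      = ∑ s, (G.cov2 G.Ric s i j - G.cov2 G.Ric j i s) * G.gradient f s := by
    simp only [con_sum, con_mul_right, div_riem]
  -- By `cov2_Ric_comm` this is the curvature contracted with the gradient in both of its last two
  -- slots, hence zero by antisymmetry.
  have h6 : ∑ s, (G.cov2 G.Ric i j s - G.cov2 G.Ric j i s) * G.gradient f s = 0 := by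
    simp only [cov2_Ric_comm hS]
    apply eq_zero_of_two_mul_eq_zero
    rw [two_mul, ← eq_neg_iff_add_eq_zero]
    conv_lhs => simp only [Finset.sum_mul]
    rw [Finset.sum_comm, ← Finset.sum_neg_distrib]
    refine Finset.sum_congr rfl fun k _ => ?_
    rw [Finset.sum_mul, ← Finset.sum_neg_distrib]
    refine Finset.sum_congr rfl fun s _ => ?_
    rw [G.riem_antisymm_right]; ring
  simp only [h2, con_add, con_cov3_cov2_Ric, h3, h4, h5, ← hQ, ← sum_mul_gradient, sub_mul,
    Finset.sum_sub_distrib] at h6 ⊢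
  rw [mul_smul, two_smul]
  linear_combination h6

end Soliton

end MetricCalculus
end RicciSoliton

namespace RicciSoliton
namespace MetricCalculus

/-! ### Hamilton's first integral and the algebra behind the Weyl form. -/

section Pointwise

variable {ι A : Type*} [Fintype ι] [DecidableEq ι] [CommRing A] [Algebra ℝ A]
  (G : MetricCalculus ι A)

lemma D_con_gradient_sq (f : A) (i : ι) : G.D i (G.con fun s t => G.D s f * G.D t f)
    = 2 * ∑ s, G.Hess f i s * G.gradient f s := by
  have e : ∑ s, G.D s f * ∑ t, G.h s t * G.Hess f i t = ∑ s, G.Hess f i s * G.gradient f s := by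
    simp only [gradient, Finset.mul_sum]
    rw [Finset.sum_comm]
    refine Finset.sum_congr rfl fun s _ => Finset.sum_congr rfl fun t _ => ?_
    rw [G.h_symm]; ring
  rw [← sum_mul_gradient, D_sum_mul]
  simp only [covUp_gradient]
  rw [e, two_mul]
  rfl

/-- The derivative of `R + |∇f|² - 2 c f` vanishes. -/
lemma D_hamilton {f : A} {c : ℝ} (hS : ∀ i j, G.Ric i j + G.Hess f i j = c • G.g i j) (i : ι) :
    G.D i (G.scalar + (G.con fun s t => G.D s f * G.D t f) - (2 * c) • f) = 0 := by
  have e : ∑ s, G.Ric i s * G.gradient f s + ∑ s, G.Hess f i s * G.gradient f s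
      = c • G.D i f := by
    rw [← Finset.sum_add_distrib, ← sum_g_mul_gradient, Finset.smul_sum]
    exact Finset.sum_congr rfl fun s _ => by rw [← add_mul, hS, smul_mul_assoc]
  rw [map_sub, map_add, Derivation.map_smul, D_con_gradient_sq, D_scalar hS, mul_smul, ← e,
    two_smul]
  ring

lemma sum_g_mul_RicUp (i j : ι) : ∑ l, G.g i l * G.RicUp j l = ∑ a, G.h j a * G.Ric a i := by
  simp only [RicUp, Finset.mul_sum]
  rw [Finset.sum_comm]
  refine Finset.sum_congr rfl fun a _ => ?_
  rw [Finset.sum_comm]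
  have : ∀ b, ∑ l, G.g i l * (G.h j a * G.h l b * G.Ric a b)
      = (∑ l, G.g i l * G.h l b) * (G.h j a * G.Ric a b) := fun b => by
    rw [Finset.sum_mul]; exact Finset.sum_congr rfl fun _ _ => by ring
  simp only [this, sum_g_mul_h]
  simp

lemma sum_mul_g_mul_RicUp (i : ι) (X : ι → A) :
    ∑ j, ∑ l, X j * G.g i l * G.RicUp j l = ∑ j, ∑ a, X j * G.h j a * G.Ric a i := by
  simp only [mul_assoc, ← Finset.mul_sum, sum_g_mul_RicUp]

lemma sum_g_mul_g_mul_RicUp (i k : ι) :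
    ∑ j, ∑ l, G.g k j * G.g i l * G.RicUp j l = G.Ric k i := by
  rw [sum_mul_g_mul_RicUp, Finset.sum_comm]
  simp only [← Finset.sum_mul, sum_g_mul_h]
  simp

lemma sum_g_contract_RicUp : ∑ j, ∑ l, G.g j l * G.RicUp j l = G.scalar := by
  simp only [sum_g_mul_RicUp, fun a j => G.Ric_symm a j]
  rfl

/-- For `a = 1/((n-1)(n-2))` and `b = 1/(n-2)` the first factor is the Weyl tensor. The identity is
linear in `a` and `b`, so they can stay arbitrary and the dimension need not enter. -/
lemma sum_weyl_mul_RicUp (i k : ι) (a b : ℝ) :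
    ∑ j, ∑ l, (G.riem i j k l + a • (G.scalar * (G.g i k * G.g j l - G.g i l * G.g j k))
      - b • (G.Ric i k * G.g j l - G.Ric i l * G.g j k + G.Ric j l * G.g i k
        - G.Ric j k * G.g i l)) * G.RicUp j l
    = ∑ j, ∑ l, G.riem i j k l * G.RicUp j l
      + a • (G.scalar * (G.g i k * G.scalar - G.Ric i k))
      - b • (G.Ric i k * G.scalar - 2 * G.RicSq i k + G.g i k * G.RicNormSq) := by
  have e1 : ∑ j, ∑ l, G.g i l * G.g j k * G.RicUp j l = G.Ric i k := by
    rw [G.Ric_symm, ← sum_g_mul_g_mul_RicUp]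
    exact Finset.sum_congr rfl fun _ _ => Finset.sum_congr rfl fun _ _ => by
      rw [G.g_symm k]; ring
  have e2 : ∑ j, ∑ l, G.Ric i l * G.g j k * G.RicUp j l = G.RicSq i k := by
    rw [Finset.sum_comm, RicSq, ← sum_mul_g_mul_RicUp]
    exact Finset.sum_congr rfl fun _ _ => Finset.sum_congr rfl fun _ _ => by
      rw [G.g_symm k, G.RicUp_symm]
  have e3 : ∑ j, ∑ l, G.Ric j k * G.g i l * G.RicUp j l = G.RicSq i k := by
    rw [sum_mul_g_mul_RicUp, Finset.sum_comm, RicSq]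
    exact Finset.sum_congr rfl fun _ _ => Finset.sum_congr rfl fun _ _ => by
      rw [G.h_symm, G.Ric_symm i]; ring
  have e4 : ∑ j, ∑ l, G.Ric j l * G.RicUp j l = G.RicNormSq := rfl
  have e5 := G.sum_g_contract_RicUp
  have key : ∀ j l, (G.riem i j k l + a • (G.scalar * (G.g i k * G.g j l - G.g i l * G.g j k))
      - b • (G.Ric i k * G.g j l - G.Ric i l * G.g j k + G.Ric j l * G.g i k
        - G.Ric j k * G.g i l)) * G.RicUp j l
      = G.riem i j k l * G.RicUp j l + a • (G.scalar * (G.g i k * (G.g j l * G.RicUp j l)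
        - G.g i l * G.g j k * G.RicUp j l))
        - b • (G.Ric i k * (G.g j l * G.RicUp j l) - G.Ric i l * G.g j k * G.RicUp j l
          + G.g i k * (G.Ric j l * G.RicUp j l) - G.Ric j k * G.g i l * G.RicUp j l) :=
    fun j l => by
      rw [sub_mul, add_mul, smul_mul_assoc, smul_mul_assoc]
      ring_nf
  simp only [key, Finset.sum_add_distrib, Finset.sum_sub_distrib, ← Finset.smul_sum,
    ← Finset.mul_sum, e1, e2, e3, e4, e5]
  ring_nf

end Pointwise

/-! ### Invariance under isometric changes of coordinates. -/

section ChangeOfCoordinates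

variable {ι A A' : Type*} [Fintype ι] [DecidableEq ι] [CommRing A] [Algebra ℝ A]
  [CommRing A'] [Algebra ℝ A']

/-- `φ` is the pullback by a change of coordinates with Jacobian `J` that is isometric. -/
structure IsIsometry (G : MetricCalculus ι A) (G' : MetricCalculus ι A') (φ : A' →ₐ[ℝ] A)
    (J : Matrix ι ι A) : Prop where
  D_map : ∀ i x, G.D i (φ x) = ∑ a, J a i * φ (G'.D a x)
  D_J : ∀ i j a, G.D i (J a j) = G.D j (J a i)
  g_eq : G.g = J.transpose * G'.g.map φ * J

namespace IsIsometry

variable {G : MetricCalculus ι A} {G' : MetricCalculus ι A'} {φ : A' →ₐ[ℝ] A} {J : Matrix ι ι A}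

lemma right_inv (H : IsIsometry G G' φ J) : J.transpose * (G'.g.map φ * J * G.h) = 1 := by
  rw [← G.g_mul_h, H.g_eq]; noncomm_ring

/-- Invertibility of `J` is not assumed: `right_inv` extracts it from the invertibility of `g`. The
formula is the inverse of `g_eq`. -/
lemma h_eq (H : IsIsometry G G' φ J) : G'.h.map φ = J * G.h * J.transpose := by
  have h1 := mul_eq_one_comm.mp H.right_inv
  have h2 : G'.h.map φ * G'.g.map φ = 1 := by
    rw [← Matrix.map_mul, G'.h_mul_g, Matrix.map_one _ (map_zero φ) (map_one φ)]
  calc G'.h.map φ = G'.h.map φ * (G'.g.map φ * J * G.h * J.transpose) := by rw [h1, mul_one]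
    _ = G'.h.map φ * G'.g.map φ * (J * G.h * J.transpose) := by noncomm_ring
    _ = _ := by rw [h2, one_mul]

/-- The transformation law of the Christoffel symbols. -/
lemma J_mul_Γ (H : IsIsometry G G' φ J) (i : ι) :
    J * G.Γ i = G.dM i J + ∑ a, J a i • ((G'.Γ a).map φ * J) := by
  -- `Jᵀ g'` can be cancelled on the left, so both sides may be compared with lowered indices, where
  -- the Christoffel symbols need no inverse metric.
  have inj : ∀ X Y : Matrix ι ι A, J.transpose * G'.g.map φ * X = J.transpose * G'.g.map φ * Y →
      X = Y := fun X Y h => by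
    have h1 : J * G.h * (J.transpose * G'.g.map φ) = 1 := by
      rw [mul_eq_one_comm]
      rw [← H.right_inv]; noncomm_ring
    calc X = J * G.h * (J.transpose * G'.g.map φ) * X := by rw [h1, one_mul]
      _ = J * G.h * (J.transpose * G'.g.map φ) * Y := by rw [mul_assoc, h, ← mul_assoc]
      _ = Y := by rw [h1, one_mul]
  apply inj
  rw [← mul_assoc, ← H.g_eq]
  -- In the derivative of `Jᵀ g' J`, `P` and its transpose collect the derivatives of `J`, and `T`
  -- those of `g'`.
  set P : ι → Matrix ι ι A := fun i => J.transpose * G'.g.map φ * G.dM i J with hP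
  set T : ι → Matrix ι ι A := fun i => J.transpose * G.dM i (G'.g.map φ) * J with hT
  have hP_symm : ∀ i l j, P i l j = P j l i := fun i l j => by
    simp only [hP, Matrix.mul_apply, dM, Matrix.map_apply, H.D_J i j]
  have hD : ∀ i j l, G.D i (G.g j l) = P i l j + T i j l + P i j l := fun i j l => by
    have e : G.dM i G.g = (P i).transpose + T i + P i := by
      have : (G'.g.map φ).transpose = G'.g.map φ := by
        ext a b; simp [G'.g_symm a b]
      rw [H.g_eq, dM_mul, dM_mul, dM_transpose]
      simp only [hP, hT, Matrix.transpose_mul, Matrix.transpose_transpose, this]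
      noncomm_ring
    exact congrFun (congrFun e j) l
  have hTe : ∀ i j l, T i j l
      = ∑ a, ∑ b, ∑ c, J a j * J b l * J c i * φ (G'.D c (G'.g a b)) := fun i j l => by
    simp only [hT, Matrix.mul_apply, Matrix.transpose_apply, dM, Matrix.map_apply, H.D_map,
      Finset.sum_mul, Finset.mul_sum]
    rw [Finset.sum_comm]
    exact Finset.sum_congr rfl fun _ _ => Finset.sum_congr rfl fun _ _ =>
      Finset.sum_congr rfl fun _ _ => by ring
  have hM : ∀ (X : Matrix ι ι A') l j, (J.transpose * X.map φ * J) l j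
      = ∑ c, ∑ b, J b l * φ (X b c) * J c j := fun X l j => by
    simp [Matrix.mul_apply, Finset.sum_mul]
  have hQ : ∀ l j, (J.transpose * G'.g.map φ * ∑ a, J a i • ((G'.Γ a).map φ * J)) l j
      = (1 / 2 : ℝ) • (T i j l + T j i l - T l i j) := fun l j => by
    have e1 : J.transpose * G'.g.map φ * ∑ a, J a i • ((G'.Γ a).map φ * J)
        = ∑ a, J a i • (J.transpose * (G'.g * G'.Γ a).map φ * J) := by
      simp only [Finset.mul_sum, Matrix.mul_smul, Matrix.map_mul, mul_assoc]
    have e2 : ∑ a, ∑ b, ∑ c, J a j * J b l * J c i * φ (G'.D c (G'.g a b))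
        = ∑ a, ∑ c, ∑ b, J a i * J b l * J c j * φ (G'.D a (G'.g c b)) := by
      calc _ = ∑ a, ∑ c, ∑ b, J a j * J b l * J c i * φ (G'.D c (G'.g a b)) :=
            Finset.sum_congr rfl fun _ _ => Finset.sum_comm
        _ = ∑ c, ∑ a, ∑ b, J a j * J b l * J c i * φ (G'.D c (G'.g a b)) := Finset.sum_comm
        _ = _ := Finset.sum_congr rfl fun _ _ => Finset.sum_congr rfl fun _ _ =>
            Finset.sum_congr rfl fun _ _ => by ring
    have e3 : ∑ a, ∑ b, ∑ c, J a i * J b l * J c j * φ (G'.D c (G'.g a b))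
        = ∑ a, ∑ c, ∑ b, J a i * J b l * J c j * φ (G'.D c (G'.g a b)) :=
      Finset.sum_congr rfl fun _ _ => Finset.sum_comm
    have e4 : ∑ a, ∑ b, ∑ c, J a i * J b j * J c l * φ (G'.D c (G'.g a b))
        = ∑ a, ∑ c, ∑ b, J a i * J b l * J c j * φ (G'.D b (G'.g a c)) :=
      Finset.sum_congr rfl fun _ _ => Finset.sum_congr rfl fun _ _ =>
        Finset.sum_congr rfl fun _ _ => by ring
    rw [e1, hTe, hTe, hTe, e2, e3, e4]
    simp only [← Finset.sum_add_distrib, ← Finset.sum_sub_distrib, Finset.smul_sum,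
      Matrix.sum_apply, Matrix.smul_apply, hM, g_mul_Γ_apply, map_smul, map_sub, map_add,
      smul_eq_mul, Finset.mul_sum]
    refine Finset.sum_congr rfl fun _ _ => Finset.sum_congr rfl fun _ _ =>
      Finset.sum_congr rfl fun _ _ => ?_
    rw [mul_smul_comm, smul_mul_assoc, mul_smul_comm]
    ring_nf
  ext l j
  -- By the symmetry of `P`, the six `P` terms in the Christoffel formula collapse to `2 * P i l j`,
  -- the inhomogeneous part of the law.
  rw [mul_add, Matrix.add_apply, hQ, g_mul_Γ_apply, hD, hD, hD, hP_symm j l i, hP_symm i j l,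
    hP_symm j i l]
  change _ = P i l j + _
  module

/-- The derivatives of `J` coming from the second derivatives of `φ u` cancel the inhomogeneous term
of `J_mul_Γ`. -/
lemma Hess_map (H : IsIsometry G G' φ J) (u : A') (i j : ι) :
    G.Hess (φ u) i j = ∑ a, ∑ b, J a i * J b j * φ (G'.Hess u a b) := by
  have h1 : ∀ c, ∑ m, J c m * G.chr m i j
      = G.D i (J c j) + ∑ a, ∑ b, J a i * (φ (G'.chr c a b) * J b j) := fun c => by
    have := congrFun (congrFun (H.J_mul_Γ i) c) j
    simpa [Matrix.mul_apply, Γ, dM, Matrix.sum_apply, Finset.mul_sum] using this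
  have h2 : ∑ m, G.chr m i j * G.D m (φ u)
      = ∑ c, (∑ m, J c m * G.chr m i j) * φ (G'.D c u) := by
    simp only [H.D_map, Finset.sum_mul, Finset.mul_sum]
    rw [Finset.sum_comm]
    exact Finset.sum_congr rfl fun _ _ => Finset.sum_congr rfl fun _ _ => by ring
  rw [Hess, cov1, h2]
  simp only [h1, H.D_map, map_sum, Derivation.leibniz, smul_eq_mul, Hess, cov1, map_sub, map_mul,
    mul_sub, Finset.sum_sub_distrib, Finset.sum_add_distrib, add_mul, Finset.mul_sum,
    Finset.sum_mul]
  have e1 : ∑ x, φ (G'.D x u) * G.D i (J x j) = ∑ x, G.D i (J x j) * φ (G'.D x u) := by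
    simp only [mul_comm]
  have e2 : ∑ x, ∑ a, J x j * (J a i * φ (G'.D a (G'.D x u)))
      = ∑ a, ∑ b, J a i * J b j * φ (G'.D a (G'.D b u)) := by
    rw [Finset.sum_comm]
    exact Finset.sum_congr rfl fun _ _ => Finset.sum_congr rfl fun _ _ => by ring
  have e3 : ∑ c, ∑ a, ∑ b, J a i * (φ (G'.chr c a b) * J b j) * φ (G'.D c u)
      = ∑ a, ∑ b, ∑ c, J a i * J b j * (φ (G'.chr c a b) * φ (G'.D c u)) := by
    rw [Finset.sum_comm]
    refine Finset.sum_congr rfl fun a _ => ?_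
    rw [Finset.sum_comm]
    exact Finset.sum_congr rfl fun _ _ => Finset.sum_congr rfl fun _ _ => by ring
  rw [e1, e2, e3]; ring

lemma con_map (H : IsIsometry G G' φ J) {S : ι → ι → A} {T : ι → ι → A'}
    (hST : ∀ i j, S i j = ∑ a, ∑ b, J a i * J b j * φ (T a b)) : G.con S = φ (G'.con T) := by
  have h1 : ∀ a b, φ (G'.h a b) = ∑ j, ∑ i, J a i * G.h i j * J b j := fun a b => by
    have := congrFun (congrFun H.h_eq a) b
    simpa [Matrix.mul_apply, Finset.sum_mul] using this
  simp only [con_apply, map_sum, map_mul, hST, h1, Finset.sum_mul, Finset.mul_sum]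
  have e1 : ∀ X : ι → ι → ι → ι → A, ∑ i, ∑ j, ∑ a, ∑ b, X i j a b
      = ∑ a, ∑ b, ∑ j, ∑ i, X i j a b := fun X => by
    calc _ = ∑ i, ∑ a, ∑ j, ∑ b, X i j a b := Finset.sum_congr rfl fun _ _ => Finset.sum_comm
      _ = ∑ a, ∑ i, ∑ j, ∑ b, X i j a b := Finset.sum_comm
      _ = ∑ a, ∑ i, ∑ b, ∑ j, X i j a b := Finset.sum_congr rfl fun _ _ =>
        Finset.sum_congr rfl fun _ _ => Finset.sum_comm
      _ = ∑ a, ∑ b, ∑ i, ∑ j, X i j a b := Finset.sum_congr rfl fun _ _ => Finset.sum_comm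
      _ = _ := Finset.sum_congr rfl fun _ _ => Finset.sum_congr rfl fun _ _ => Finset.sum_comm
  rw [e1]
  exact Finset.sum_congr rfl fun _ _ => Finset.sum_congr rfl fun _ _ =>
    Finset.sum_congr rfl fun _ _ => Finset.sum_congr rfl fun _ _ => by ring

lemma con_Hess_map (H : IsIsometry G G' φ J) (u : A') :
    G.con (G.Hess (φ u)) = φ (G'.con (G'.Hess u)) := H.con_map (H.Hess_map u)

lemma con_gradient_map (H : IsIsometry G G' φ J) (u v : A') :
    G.con (fun i j => G.D i (φ u) * G.D j (φ v))
      = φ (G'.con fun i j => G'.D i u * G'.D j v) := by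
  refine H.con_map fun i j => ?_
  simp only [H.D_map, Finset.sum_mul_sum, map_mul]
  exact Finset.sum_congr rfl fun _ _ => Finset.sum_congr rfl fun _ _ => by ring

end IsIsometry

end ChangeOfCoordinates

end MetricCalculus
end RicciSoliton

/-! ### The algebra of smooth functions on an open set. -/

namespace RicciSoliton

open TopologicalSpace

variable {n : ℕ}

lemma contDiffOn_pd {U : Set (EuclideanSpace ℝ (Fin n))} (hU : IsOpen U)
    {u : EuclideanSpace ℝ (Fin n) → ℝ} (hu : ContDiffOn ℝ ∞ u U) (i : Fin n) :
    ContDiffOn ℝ ∞ (pd i u) U :=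
  (hu.fderiv_of_isOpen hU (by norm_num)).clm_apply contDiffOn_const

lemma pd_congr {U : Set (EuclideanSpace ℝ (Fin n))} (hU : IsOpen U)
    {u v : EuclideanSpace ℝ (Fin n) → ℝ} (h : Set.EqOn u v U) (i : Fin n) :
    Set.EqOn (pd i u) (pd i v) U := fun y hy => by
  unfold pd
  rw [(h.eventuallyEq_of_mem (hU.mem_nhds hy)).fderiv_eq]

lemma pd_comm {U : Set (EuclideanSpace ℝ (Fin n))} (hU : IsOpen U)
    {u : EuclideanSpace ℝ (Fin n) → ℝ} (hu : ContDiffOn ℝ ∞ u U) (i j : Fin n)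
    {y : EuclideanSpace ℝ (Fin n)} (hy : y ∈ U) : pd i (pd j u) y = pd j (pd i u) y := by
  have hd : DifferentiableAt ℝ (fderiv ℝ u) y :=
    ((hu.fderiv_of_isOpen hU (m := ∞) (by norm_num)).differentiableOn (by norm_num)).differentiableAt
      (hU.mem_nhds hy)
  have e : ∀ i j, pd i (pd j u) y
      = fderiv ℝ (fderiv ℝ u) y (EuclideanSpace.single i 1) (EuclideanSpace.single j 1) :=
    fun i j => by
      unfold pd
      rw [fderiv_clm_apply hd (differentiableAt_const _)]
      simp
  rw [e, e]
  exact ((hu.contDiffAt (hU.mem_nhds hy)).isSymmSndFDerivAt (by simp [ENat.LEInfty.out])) _ _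

variable {U : Opens (EuclideanSpace ℝ (Fin n))}

/-- The extension by zero of a function on `U`. -/
def extendZero (F : U → ℝ) : EuclideanSpace ℝ (Fin n) → ℝ := Function.extend (↑) F 0

lemma extendZero_apply (F : U → ℝ) (y : U) : extendZero F y = F y :=
  Subtype.val_injective.extend_apply F 0 y

lemma contDiffOn_extendZero {F : U → ℝ} {u : EuclideanSpace ℝ (Fin n) → ℝ}
    (hu : ContDiffOn ℝ ∞ u U) (h : ∀ y : U, F y = u y) : ContDiffOn ℝ ∞ (extendZero F) U :=
  hu.congr fun y hy => (extendZero_apply F ⟨y, hy⟩).trans (h ⟨y, hy⟩)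

/-- The algebra of smooth functions on `U`. -/
def smoothOn (U : Opens (EuclideanSpace ℝ (Fin n))) : Subalgebra ℝ (U → ℝ) where
  carrier := {F | ContDiffOn ℝ ∞ (extendZero F) U}
  mul_mem' {F F'} hu hv := contDiffOn_extendZero (ContDiffOn.mul hu hv) fun y => by
    simp [extendZero_apply]
  add_mem' {F F'} hu hv := contDiffOn_extendZero (ContDiffOn.add hu hv) fun y => by
    simp [extendZero_apply]
  algebraMap_mem' c := contDiffOn_extendZero (contDiffOn_const (c := c)) fun y => rfl

/-- The restriction of a smooth function to `U`. -/
def smoothOn.res (u : EuclideanSpace ℝ (Fin n) → ℝ) (hu : ContDiffOn ℝ ∞ u U) : smoothOn U :=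
  ⟨fun y => u y, contDiffOn_extendZero hu fun _ => rfl⟩

lemma differentiableAt_extendZero (x : smoothOn U) (y : U) :
    DifferentiableAt ℝ (extendZero (x : U → ℝ)) y :=
  (x.2.differentiableOn (by norm_num)).differentiableAt (U.2.mem_nhds y.2)

/-- On the open set `U` a derivative depends only on values in `U`, so any extension agreeing there
gives the same result. -/
lemma pd_extendZero {F : U → ℝ} {u : EuclideanSpace ℝ (Fin n) → ℝ} (h : ∀ y : U, F y = u y)
    (i : Fin n) (y : U) : pd i (extendZero F) y = pd i u y :=
  pd_congr U.2 (fun y hy => (extendZero_apply F ⟨y, hy⟩).trans (h ⟨y, hy⟩)) i y.2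

/-- The partial derivative as a derivation. -/
def pdDerivation (U : Opens (EuclideanSpace ℝ (Fin n))) (i : Fin n) :
    Derivation ℝ (smoothOn U) (smoothOn U) :=
  Derivation.mk'
    { toFun := fun x => smoothOn.res (pd i (extendZero (x : U → ℝ))) (contDiffOn_pd U.2 x.2 i)
      map_add' := fun x x' => by
        ext y
        change pd i (extendZero ((x : U → ℝ) + (x' : U → ℝ))) y = _
        rw [pd_extendZero (u := extendZero (x : U → ℝ) + extendZero (x' : U → ℝ))
          (fun y => by simp [extendZero_apply]), pd,
          fderiv_add (differentiableAt_extendZero x y) (differentiableAt_extendZero x' y)]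
        rfl
      map_smul' := fun c x => by
        ext y
        change pd i (extendZero (c • (x : U → ℝ))) y = _
        rw [pd_extendZero (u := c • extendZero (x : U → ℝ))
          (fun y => by simp [extendZero_apply]), pd, fderiv_const_smul (differentiableAt_extendZero x y)]
        rfl }
    fun x x' => by
      ext y
      change pd i (extendZero ((x : U → ℝ) * (x' : U → ℝ))) y = (x : U → ℝ) y * pd i (extendZero (x' : U → ℝ)) y
        + (x' : U → ℝ) y * pd i (extendZero (x : U → ℝ)) y
      rw [pd_extendZero (u := extendZero (x : U → ℝ) * extendZero (x' : U → ℝ))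
        (fun y => by simp [extendZero_apply]), pd,
        fderiv_mul (differentiableAt_extendZero x y) (differentiableAt_extendZero x' y)]
      simp [extendZero_apply, pd]

/-- The element `x` of `smoothOn U` is the restriction of `u`. -/
def Rep (x : smoothOn U) (u : EuclideanSpace ℝ (Fin n) → ℝ) : Prop :=
  ∀ y : U, (x : U → ℝ) y = u y

namespace Rep

variable {x x' : smoothOn U} {u u' : EuclideanSpace ℝ (Fin n) → ℝ}

lemma res (hu : ContDiffOn ℝ ∞ u U) : Rep (smoothOn.res u hu) u := fun _ => rfl

lemma add (h : Rep x u) (h' : Rep x' u') : Rep (x + x') fun y => u y + u' y :=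
  fun y => by simp [h y, h' y]

lemma sub (h : Rep x u) (h' : Rep x' u') : Rep (x - x') fun y => u y - u' y :=
  fun y => by simp [h y, h' y]

lemma mul (h : Rep x u) (h' : Rep x' u') : Rep (x * x') fun y => u y * u' y :=
  fun y => by simp [h y, h' y]

lemma neg (h : Rep x u) : Rep (-x) fun y => -u y :=
  fun y => by simp [h y]

lemma smul (c : ℝ) (h : Rep x u) : Rep (c • x) fun y => c * u y :=
  fun y => by simp [h y]

lemma sum {ι : Type*} {s : Finset ι} {x : ι → smoothOn U}
    {u : ι → EuclideanSpace ℝ (Fin n) → ℝ} (h : ∀ i, Rep (x i) (u i)) :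
    Rep (∑ i ∈ s, x i) fun y => ∑ i ∈ s, u i y := fun y => by
  rw [AddSubmonoidClass.coe_finsetSum, Finset.sum_apply]
  exact Finset.sum_congr rfl fun i _ => h i y

lemma pd (h : Rep x u) (i : Fin n) : Rep (pdDerivation U i x) (pd i u) :=
  fun y => pd_extendZero h i y

lemma extendZero (x : smoothOn U) : Rep x (extendZero (x : U → ℝ)) :=
  fun y => (extendZero_apply _ y).symm

lemma contDiffOn (h : Rep x u) : ContDiffOn ℝ ∞ u U :=
  x.2.congr fun y hy => (h ⟨y, hy⟩).symm.trans (Rep.extendZero x ⟨y, hy⟩)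

/-- Transfers pointwise identities on `U` into the algebra; `Rep.eq` is the passage back. -/
lemma ext (h : Rep x u) (h' : Rep x' u') (e : ∀ y ∈ U, u y = u' y) : x = x' := by
  ext y; rw [h y, h' y, e y y.2]

end Rep

lemma pdDerivation_comm (i j : Fin n) (x : smoothOn U) :
    pdDerivation U i (pdDerivation U j x) = pdDerivation U j (pdDerivation U i x) :=
  (((Rep.extendZero x).pd j).pd i).ext (((Rep.extendZero x).pd i).pd j)
    fun _ hy => pd_comm U.2 x.2 i j hy

/-! ### Dictionary between the abstract calculus and the coordinate definitions. -/

/-- `g` is a smooth, symmetric and nondegenerate matrix of functions on `U`. -/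
structure IsMetricOn (U : Opens (EuclideanSpace ℝ (Fin n)))
    (g : Fin n → Fin n → EuclideanSpace ℝ (Fin n) → ℝ) : Prop where
  smooth : ∀ i j, ContDiffOn ℝ ∞ (g i j) U
  symm : ∀ i j y, g i j y = g j i y
  det_ne_zero : ∀ y ∈ U, (Matrix.of fun i j => g i j y).det ≠ 0

lemma contDiffOn_det {s : Set (EuclideanSpace ℝ (Fin n))}
    {M : EuclideanSpace ℝ (Fin n) → Matrix (Fin n) (Fin n) ℝ}
    (h : ∀ i j, ContDiffOn ℝ ∞ (fun y => M y i j) s) : ContDiffOn ℝ ∞ (fun y => (M y).det) s := by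
  simp only [Matrix.det_apply]
  exact ContDiffOn.sum fun σ _ => (contDiffOn_prod fun i _ => h (σ i) i).const_smul _

namespace IsMetricOn

variable {g : Fin n → Fin n → EuclideanSpace ℝ (Fin n) → ℝ} (hg : IsMetricOn U g)
include hg

/-- Cramer's rule: the entries of the inverse are quotients of polynomials in the `g i j`, with
nonvanishing denominator. -/
lemma contDiffOn_ginv (i j : Fin n) : ContDiffOn ℝ ∞ (ginv g i j) U := by
  have e : ginv g i j = fun y => ((Matrix.of fun a b => g a b y).det)⁻¹
      * ((Matrix.of fun a b => g a b y).updateRow j (Pi.single i 1)).det := by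
    ext y
    rw [ginv, Matrix.inv_def, Matrix.smul_apply, Matrix.adjugate_apply, Ring.inverse_eq_inv',
      smul_eq_mul]
  rw [e]
  refine ((contDiffOn_det fun i j => hg.smooth i j).inv hg.det_ne_zero).mul
    (contDiffOn_det fun a b => ?_)
  by_cases ha : a = j
  · subst ha; simp only [Matrix.updateRow_self]; exact contDiffOn_const
  · simp only [Matrix.updateRow_ne ha]; exact hg.smooth a b

/-- The tensor calculus of the metric `g` on `U`. -/
def calculus : MetricCalculus (Fin n) (smoothOn U) where
  D := pdDerivation U
  D_comm := pdDerivation_comm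
  g := Matrix.of fun i j => smoothOn.res (g i j) (hg.smooth i j)
  h := Matrix.of fun i j => smoothOn.res (ginv g i j) (hg.contDiffOn_ginv i j)
  g_symm i j := (Rep.res (hg.smooth i j)).ext (Rep.res (hg.smooth j i)) fun y _ => hg.symm i j y
  g_mul_h := by
    ext i j y
    rw [Matrix.mul_apply]
    change ((∑ k, smoothOn.res (g i k) (hg.smooth i k)
      * smoothOn.res (ginv g k j) (hg.contDiffOn_ginv k j) : smoothOn U) : U → ℝ) y = _
    have e1 : ((1 : Matrix (Fin n) (Fin n) (smoothOn U)) i j : U → ℝ) y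
        = (1 : Matrix (Fin n) (Fin n) ℝ) i j := by
      by_cases hij : i = j <;> simp [Matrix.one_apply, hij]
    rw [e1, Rep.sum (fun k => (Rep.res (hg.smooth i k)).mul (Rep.res (hg.contDiffOn_ginv k j))) y,
      ← Matrix.mul_nonsing_inv (Matrix.of fun a b => g a b y)
        (isUnit_iff_ne_zero.mpr (hg.det_ne_zero y y.2)), Matrix.mul_apply]
    rfl

lemma rep_g (i j : Fin n) : Rep (hg.calculus.g i j) (g i j) := fun _ => rfl

lemma rep_h (i j : Fin n) : Rep (hg.calculus.h i j) (ginv g i j) := fun _ => rfl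

lemma rep_D {x : smoothOn U} {u : EuclideanSpace ℝ (Fin n) → ℝ} (h : Rep x u) (i : Fin n) :
    Rep (hg.calculus.D i x) (pd i u) := h.pd i

lemma rep_chr (k i j : Fin n) : Rep (hg.calculus.chr k i j) (christoffel g k i j) :=
  (Rep.sum fun l => (hg.rep_h k l).mul (((hg.rep_D (hg.rep_g j l) i).add (hg.rep_D (hg.rep_g i l) j)).sub
    (hg.rep_D (hg.rep_g i j) l))).smul _

lemma rep_con {T : Fin n → Fin n → smoothOn U} {t : Fin n → Fin n → EuclideanSpace ℝ (Fin n) → ℝ}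
    (h : ∀ i j, Rep (T i j) (t i j)) :
    Rep (hg.calculus.con T) fun y => ∑ i, ∑ j, ginv g i j y * t i j y :=
  Rep.sum fun i => Rep.sum fun j => (hg.rep_h i j).mul (h i j)

lemma rep_cov1 {w : Fin n → smoothOn U} {w' : Fin n → EuclideanSpace ℝ (Fin n) → ℝ}
    (h : ∀ i, Rep (w i) (w' i)) (i j : Fin n) : Rep (hg.calculus.cov1 w i j) (cov1 g w' i j) :=
  (hg.rep_D (h j) i).sub (Rep.sum fun m => (hg.rep_chr m i j).mul (h m))

lemma rep_cov2 {T : Fin n → Fin n → smoothOn U} {t : Fin n → Fin n → EuclideanSpace ℝ (Fin n) → ℝ}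
    (h : ∀ i j, Rep (T i j) (t i j)) (i j k : Fin n) :
    Rep (hg.calculus.cov2 T i j k) (cov2 g t i j k) :=
  ((hg.rep_D (h j k) i).sub (Rep.sum fun m => (hg.rep_chr m i j).mul (h m k))).sub
    (Rep.sum fun m => (hg.rep_chr m i k).mul (h j m))

lemma rep_cov3 {T : Fin n → Fin n → Fin n → smoothOn U}
    {t : Fin n → Fin n → Fin n → EuclideanSpace ℝ (Fin n) → ℝ}
    (h : ∀ i j k, Rep (T i j k) (t i j k)) (i j k l : Fin n) :
    Rep (hg.calculus.cov3 T i j k l) (cov3 g t i j k l) :=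
  (((hg.rep_D (h j k l) i).sub (Rep.sum fun m => (hg.rep_chr m i j).mul (h m k l))).sub
    (Rep.sum fun m => (hg.rep_chr m i k).mul (h j m l))).sub
    (Rep.sum fun m => (hg.rep_chr m i l).mul (h j k m))

lemma rep_Hess {x : smoothOn U} {u : EuclideanSpace ℝ (Fin n) → ℝ} (h : Rep x u) (i j : Fin n) :
    Rep (hg.calculus.Hess x i j) (hess g u i j) :=
  hg.rep_cov1 (fun k => hg.rep_D h k) i j

lemma rep_laplacian {x : smoothOn U} {u : EuclideanSpace ℝ (Fin n) → ℝ} (h : Rep x u) :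
    Rep (hg.calculus.con (hg.calculus.Hess x)) (laplacian g u) :=
  hg.rep_con fun i j => hg.rep_Hess h i j

lemma rep_gradient {x : smoothOn U} {u : EuclideanSpace ℝ (Fin n) → ℝ} (h : Rep x u) (i : Fin n) :
    Rep (hg.calculus.gradient x i) (grad g u i) :=
  Rep.sum fun j => (hg.rep_h i j).mul (hg.rep_D h j)

lemma rep_gradInner {x x' : smoothOn U} {u u' : EuclideanSpace ℝ (Fin n) → ℝ} (h : Rep x u)
    (h' : Rep x' u') : Rep (hg.calculus.con fun i j => hg.calculus.D i x * hg.calculus.D j x')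
      (gradInner g u u') := fun y => by
  rw [hg.rep_con (fun i j => (hg.rep_D h i).mul (hg.rep_D h' j)) y]
  simp only [gradInner, mul_assoc]

lemma rep_riem (i j k l : Fin n) : Rep (hg.calculus.riem i j k l) (riemann g i j k l) := by
  refine (Rep.sum fun s => (hg.rep_g l s).mul ?_).neg
  rw [MetricCalculus.F_apply]
  exact ((hg.rep_D (hg.rep_chr s j k) i).sub (hg.rep_D (hg.rep_chr s i k) j)).add (Rep.sum fun m =>
    ((hg.rep_chr s i m).mul (hg.rep_chr m j k)).sub ((hg.rep_chr s j m).mul (hg.rep_chr m i k)))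

lemma rep_Ric (i k : Fin n) : Rep (hg.calculus.Ric i k) (ricci g i k) :=
  hg.rep_con fun j l => hg.rep_riem i j k l

lemma rep_scalar : Rep hg.calculus.scalar (scal g) := hg.rep_con hg.rep_Ric

lemma rep_RicUp (i j : Fin n) : Rep (hg.calculus.RicUp i j) (ricciUp g i j) :=
  Rep.sum fun a => Rep.sum fun b => ((hg.rep_h i a).mul (hg.rep_h j b)).mul (hg.rep_Ric a b)

lemma rep_RicSq (i k : Fin n) : Rep (hg.calculus.RicSq i k) (ricciSq g i k) :=
  Rep.sum fun j => Rep.sum fun l => ((hg.rep_Ric i j).mul (hg.rep_h j l)).mul (hg.rep_Ric l k)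

lemma rep_RicNormSq : Rep hg.calculus.RicNormSq (ricciNormSq g) :=
  Rep.sum fun i => Rep.sum fun j => (hg.rep_Ric i j).mul (hg.rep_RicUp i j)

lemma rep_con_RicSq : Rep (hg.calculus.con hg.calculus.RicSq) (ricciSqTrace g) :=
  hg.rep_con hg.rep_RicSq

lemma rep_laplacian_Ric (i j : Fin n) :
    Rep (hg.calculus.con fun p q => hg.calculus.cov3 (hg.calculus.cov2 hg.calculus.Ric) p q i j)
      (laplacian2 g (ricci g) i j) :=
  hg.rep_con fun p q => hg.rep_cov3 (fun i j k => hg.rep_cov2 hg.rep_Ric i j k) p q i j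

lemma rep_gradInner_Ric {x : smoothOn U} {u : EuclideanSpace ℝ (Fin n) → ℝ} (h : Rep x u)
    (i j : Fin n) :
    Rep (hg.calculus.con fun p q =>
      hg.calculus.cov2 hg.calculus.Ric p i j * hg.calculus.D q x)
      (gradInner2 g (ricci g) u i j) := fun y => by
  rw [hg.rep_con (fun p q => (hg.rep_cov2 hg.rep_Ric p i j).mul (hg.rep_D h q)) y]
  simp only [gradInner2, mul_assoc]

end IsMetricOn

end RicciSoliton

/-! ### The metric in charts and its transformation law. -/

namespace RicciSoliton

open TopologicalSpace

lemma euclidean_eq_sum {n : ℕ} (v : EuclideanSpace ℝ (Fin n)) :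
    v = ∑ a, v a • EuclideanSpace.single a (1 : ℝ) := by
  have := (EuclideanSpace.basisFun (Fin n) ℝ).sum_repr v
  simpa using this.symm

lemma pd_apply {n : ℕ} {ψ : EuclideanSpace ℝ (Fin n) → EuclideanSpace ℝ (Fin n)}
    {y : EuclideanSpace ℝ (Fin n)} (hd : DifferentiableAt ℝ ψ y) (i a : Fin n) :
    pd i (fun z => ψ z a) y = (fderiv ℝ ψ y (EuclideanSpace.single i 1)) a := by
  have := ((EuclideanSpace.proj a : EuclideanSpace ℝ (Fin n) →L[ℝ] ℝ).hasFDerivAt.comp y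
    hd.hasFDerivAt).fderiv
  exact DFunLike.congr_fun this (EuclideanSpace.single i 1)

/-- The chain rule. -/
lemma pd_comp {n : ℕ} {ψ : EuclideanSpace ℝ (Fin n) → EuclideanSpace ℝ (Fin n)}
    {u : EuclideanSpace ℝ (Fin n) → ℝ} {y : EuclideanSpace ℝ (Fin n)}
    (hu : DifferentiableAt ℝ u (ψ y)) (hd : DifferentiableAt ℝ ψ y) (i : Fin n) :
    pd i (u ∘ ψ) y = ∑ a, pd i (fun z => ψ z a) y * pd a u (ψ y) := by
  simp only [pd_apply hd]
  rw [pd, fderiv_comp y hu hd, ContinuousLinearMap.comp_apply]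
  conv_lhs => rw [euclidean_eq_sum (fderiv ℝ ψ y (EuclideanSpace.single i 1)), map_sum]
  simp only [map_smul, smul_eq_mul, pd]

section Charts

variable {n : ℕ} {M : Type*} [TopologicalSpace M] [ChartedSpace (EuclideanSpace ℝ (Fin n)) M]

/-- The domain of the inverse of a chart. -/
def chartTarget (e : OpenPartialHomeomorph M (EuclideanSpace ℝ (Fin n))) :
    Opens (EuclideanSpace ℝ (Fin n)) := ⟨e.target, e.open_target⟩

variable {e e' : OpenPartialHomeomorph M (EuclideanSpace ℝ (Fin n))}

lemma mdifferentiable_of_mem_maximalAtlas (he : e ∈ IsManifold.maximalAtlas (𝓡 n) ∞ M) :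
    e.MDifferentiable (𝓡 n) (𝓡 n) :=
  ⟨(contMDiffOn_of_mem_maximalAtlas he).mdifferentiableOn (by simp),
    (contMDiffOn_symm_of_mem_maximalAtlas he).mdifferentiableOn (by simp)⟩

lemma contDiffOn_comp_symm (he : e ∈ IsManifold.maximalAtlas (𝓡 n) ∞ M) {f : M → ℝ}
    (hf : ContMDiff (𝓡 n) 𝓘(ℝ) ∞ f) : ContDiffOn ℝ ∞ (f ∘ e.symm) e.target :=
  contMDiffOn_iff_contDiffOn.mp (hf.comp_contMDiffOn (contMDiffOn_symm_of_mem_maximalAtlas he))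

lemma contDiffOn_transition (he : e ∈ IsManifold.maximalAtlas (𝓡 n) ∞ M)
    (he' : e' ∈ IsManifold.maximalAtlas (𝓡 n) ∞ M) :
    ContDiffOn ℝ ∞ (e' ∘ e.symm) (e.symm.trans e').source := by
  rw [← contMDiffOn_iff_contDiffOn]
  refine (contMDiffOn_of_mem_maximalAtlas he').comp
    ((contMDiffOn_symm_of_mem_maximalAtlas he).mono fun y hy => ?_) fun y hy => ?_
  · exact hy.1
  · exact hy.2

section Transition

variable [RiemannianBundle (fun x : M => TangentSpace (𝓡 n) x)]

/-- The inner product at the point `x` as a function on the model space. -/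
def innerAt (x : M) (v w : EuclideanSpace ℝ (Fin n)) : ℝ :=
  @inner ℝ (TangentSpace (𝓡 n) x) _ v w

lemma innerAt_sum_left (x : M) {ι : Type*} (s : Finset ι) (v : ι → EuclideanSpace ℝ (Fin n))
    (w : EuclideanSpace ℝ (Fin n)) : innerAt x (∑ a ∈ s, v a) w = ∑ a ∈ s, innerAt x (v a) w :=
  sum_inner (𝕜 := ℝ) (E := TangentSpace (𝓡 n) x) s v w

lemma innerAt_sum_right (x : M) {ι : Type*} (s : Finset ι) (v : EuclideanSpace ℝ (Fin n))
    (w : ι → EuclideanSpace ℝ (Fin n)) : innerAt x v (∑ a ∈ s, w a) = ∑ a ∈ s, innerAt x v (w a) :=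
  inner_sum (𝕜 := ℝ) (E := TangentSpace (𝓡 n) x) s w v

lemma innerAt_smul_left (x : M) (c : ℝ) (v w : EuclideanSpace ℝ (Fin n)) :
    innerAt x (c • v) w = c * innerAt x v w :=
  real_inner_smul_left (F := TangentSpace (𝓡 n) x) v w c

lemma innerAt_smul_right (x : M) (c : ℝ) (v w : EuclideanSpace ℝ (Fin n)) :
    innerAt x v (c • w) = c * innerAt x v w :=
  real_inner_smul_right (F := TangentSpace (𝓡 n) x) v w c

/-- The transformation law of the metric. -/
lemma metricIn_transition (he : e ∈ IsManifold.maximalAtlas (𝓡 n) ∞ M)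
    (he' : e' ∈ IsManifold.maximalAtlas (𝓡 n) ∞ M) {y : EuclideanSpace ℝ (Fin n)}
    (hy : y ∈ (e.symm.trans e').source) (i j : Fin n) :
    metricIn e i j y = ∑ a, ∑ b, pd i (fun z => e' (e.symm z) a) y
      * pd j (fun z => e' (e.symm z) b) y * metricIn e' a b (e' (e.symm y)) := by
  have hd : DifferentiableAt ℝ (e' ∘ e.symm) y :=
    ((contDiffOn_transition he he').differentiableOn (by simp)).differentiableAt
      ((e.symm.trans e').open_source.mem_nhds hy)
  have hx : e'.symm ((e' ∘ e.symm) y) = e.symm y := e'.left_inv hy.2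
  have hpd : ∀ i a, pd i (fun z => e' (e.symm z) a) y
      = (fderiv ℝ (e' ∘ e.symm) y (EuclideanSpace.single i 1)) a := fun i a => pd_apply hd i a
  set L : EuclideanSpace ℝ (Fin n) →L[ℝ] EuclideanSpace ℝ (Fin n) :=
    mfderiv (𝓡 n) (𝓡 n) e'.symm ((e' ∘ e.symm) y) with hL
  -- Near `y` the inverse chart `e.symm` factors as `e'.symm` after the transition map, so the chain
  -- rule applies.
  have hframe : ∀ v : EuclideanSpace ℝ (Fin n),
      (mfderiv (𝓡 n) (𝓡 n) e.symm y v : EuclideanSpace ℝ (Fin n))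
        = L (fderiv ℝ (e' ∘ e.symm) y v) := fun v => by
    have h1 : e.symm =ᶠ[nhds y] e'.symm ∘ (e' ∘ e.symm) := by
      filter_upwards [(e.symm.trans e').open_source.mem_nhds hy] with z hz
      exact (e'.left_inv hz.2).symm
    have h2 : MDifferentiableAt (𝓡 n) (𝓡 n) e'.symm ((e' ∘ e.symm) y) :=
      (mdifferentiable_of_mem_maximalAtlas he').mdifferentiableAt_symm (e'.map_source hy.2)
    have h3 := (h2.hasMFDerivAt.comp y hd.hasFDerivAt.hasMFDerivAt).congr_of_eventuallyEq h1
    have h4 := h3.mfderiv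
    exact DFunLike.congr_fun h4 v
  have hexp : ∀ i, (mfderiv (𝓡 n) (𝓡 n) e.symm y (EuclideanSpace.single i (1 : ℝ)) :
      EuclideanSpace ℝ (Fin n))
        = ∑ a, pd i (fun z => e' (e.symm z) a) y • L (EuclideanSpace.single a (1 : ℝ)) :=
    fun i => by
      rw [hframe, euclidean_eq_sum (fderiv ℝ (e' ∘ e.symm) y (EuclideanSpace.single i 1)), map_sum]
      simp only [map_smul, hpd]
      rfl
  have hsum : ∀ (x : M) (c d : Fin n → ℝ) (w : Fin n → EuclideanSpace ℝ (Fin n)),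
      innerAt x (∑ a, c a • w a) (∑ b, d b • w b) = ∑ a, ∑ b, c a * d b * innerAt x (w a) (w b) :=
    fun x c d w => by
      rw [innerAt_sum_left]
      simp only [innerAt_sum_right, innerAt_smul_left, innerAt_smul_right, mul_assoc,
        mul_left_comm]
  have h0 : ∀ e : OpenPartialHomeomorph M (EuclideanSpace ℝ (Fin n)), ∀ i j y,
      metricIn e i j y = innerAt (e.symm y)
        (mfderiv (𝓡 n) (𝓡 n) e.symm y (EuclideanSpace.single i (1 : ℝ)) :
          EuclideanSpace ℝ (Fin n))
        (mfderiv (𝓡 n) (𝓡 n) e.symm y (EuclideanSpace.single j (1 : ℝ)) :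
          EuclideanSpace ℝ (Fin n)) := fun _ _ _ _ => rfl
  rw [h0, hexp, hexp]
  -- The two base points are only propositionally equal; since `innerAt` takes vectors in the fixed
  -- model space, the equality can be transported without dependent types.
  exact (congrArg (fun x => innerAt x _ _) hx.symm).trans (hsum _ _ _ _)

end Transition

variable [IsManifold (𝓡 n) ∞ M]

/-- The coordinate frame is smooth. -/
lemma contMDiffOn_frame (he : e ∈ IsManifold.maximalAtlas (𝓡 n) ∞ M)
    (v : EuclideanSpace ℝ (Fin n)) :
    ContMDiffOn (𝓡 n) (𝓡 n).tangent ∞ (fun y => (⟨e.symm y, mfderiv (𝓡 n) (𝓡 n) e.symm y v⟩ :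
      TangentBundle (𝓡 n) M)) e.target := by
  have h1 := (contMDiffOn_symm_of_mem_maximalAtlas he).contMDiffOn_tangentMapWithin (m := ∞)
    (by simp) e.open_target.uniqueMDiffOn
  have h2 : ContMDiffOn (𝓡 n) (𝓡 n).tangent ∞ (fun y : EuclideanSpace ℝ (Fin n) =>
      (⟨y, v⟩ : TangentBundle (𝓡 n) (EuclideanSpace ℝ (Fin n)))) e.target :=
    contMDiffOn_vectorSpace_iff_contDiffOn.mpr contDiffOn_const
  refine (h1.comp h2 fun y hy => hy).congr fun y hy => ?_
  simp only [Function.comp_apply, tangentMapWithin]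
  rw [mfderivWithin_of_isOpen e.open_target hy]

variable [RiemannianBundle (fun x : M => TangentSpace (𝓡 n) x)]

/-- Nondegeneracy: the matrix is the Gram matrix of the coordinate frame, which is independent
because the differential of the inverse chart is injective. -/
lemma isMetricOn_metricIn [IsContMDiffRiemannianBundle (𝓡 n) ∞ (EuclideanSpace ℝ (Fin n))
      (fun x : M => TangentSpace (𝓡 n) x)] (he : e ∈ IsManifold.maximalAtlas (𝓡 n) ∞ M) :
    IsMetricOn (chartTarget e) (metricIn e) where
  smooth i j := contMDiffOn_iff_contDiffOn.mp
    ((contMDiffOn_frame he _).inner_bundle (contMDiffOn_frame he _))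
  symm i j y := real_inner_comm _ _
  det_ne_zero y hy := by
    let L : EuclideanSpace ℝ (Fin n) →ₗ[ℝ] TangentSpace (𝓡 n) (e.symm y) :=
      (mfderiv (𝓡 n) (𝓡 n) e.symm y).toLinearMap
    have hL : Function.Injective L := by
      have := (mdifferentiable_of_mem_maximalAtlas he).comp_symm_deriv hy
      refine Function.LeftInverse.injective
        (g := (mfderiv (𝓡 n) (𝓡 n) e (e.symm y) : _ → EuclideanSpace ℝ (Fin n))) fun v => ?_
      exact DFunLike.congr_fun this v
    have hb : LinearIndependent ℝ fun i : Fin n => EuclideanSpace.single i (1 : ℝ) := by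
      have h := (EuclideanSpace.basisFun (Fin n) ℝ).toBasis.linearIndependent
      rw [OrthonormalBasis.coe_toBasis] at h
      have e : ⇑(EuclideanSpace.basisFun (Fin n) ℝ) = fun i => EuclideanSpace.single i (1 : ℝ) := by
        ext1 i; simp
      rwa [e] at h
    have := hb.map' L (LinearMap.ker_eq_bot.mpr hL)
    exact Matrix.det_gram_ne_zero_iff_linearIndependent.mpr this

end Charts

end RicciSoliton

namespace RicciSoliton

open TopologicalSpace

/-! ### Pullback along transition maps and independence of the chart. -/

section Pullback

variable {n : ℕ} {U V : Opens (EuclideanSpace ℝ (Fin n))}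

lemma IsMetricOn.mono {g : Fin n → Fin n → EuclideanSpace ℝ (Fin n) → ℝ} (hg : IsMetricOn V g)
    (h : U ≤ V) : IsMetricOn U g :=
  ⟨fun i j => (hg.smooth i j).mono h, hg.symm, fun y hy => hg.det_ne_zero y (h hy)⟩

/-- The pullback of smooth functions. -/
def pullback {ψ : EuclideanSpace ℝ (Fin n) → EuclideanSpace ℝ (Fin n)}
    (hψ : ContDiffOn ℝ ∞ ψ U) (hm : Set.MapsTo ψ U V) : smoothOn V →ₐ[ℝ] smoothOn U where
  toFun x := ⟨fun y => (x : V → ℝ) ⟨ψ y, hm y.2⟩,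
    contDiffOn_extendZero (x.2.comp hψ hm) fun y => (extendZero_apply (x : V → ℝ) ⟨ψ y, hm y.2⟩).symm⟩
  map_one' := rfl
  map_mul' _ _ := rfl
  map_zero' := rfl
  map_add' _ _ := rfl
  commutes' _ := rfl

lemma Rep.pullback {ψ : EuclideanSpace ℝ (Fin n) → EuclideanSpace ℝ (Fin n)}
    (hψ : ContDiffOn ℝ ∞ ψ U) (hm : Set.MapsTo ψ U V) {x : smoothOn V}
    {u : EuclideanSpace ℝ (Fin n) → ℝ} (h : Rep x u) :
    Rep (RicciSoliton.pullback hψ hm x) (u ∘ ψ) := fun y => h ⟨ψ y, hm y.2⟩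

lemma Rep.eq {x x' : smoothOn U} {u u' : EuclideanSpace ℝ (Fin n) → ℝ} (h : Rep x u)
    (h' : Rep x' u') (e : x = x') {y : EuclideanSpace ℝ (Fin n)} (hy : y ∈ U) : u y = u' y := by
  rw [← h ⟨y, hy⟩, ← h' ⟨y, hy⟩, e]

lemma Rep.two_mul {x : smoothOn U} {u : EuclideanSpace ℝ (Fin n) → ℝ} (h : Rep x u) :
    Rep (2 * x) fun y => 2 * u y := fun y => by
  simp only [_root_.two_mul]
  exact h.add h y

lemma Rep.const (c : ℝ) : Rep (algebraMap ℝ (smoothOn U) c) fun _ => c := fun _ => rfl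

/-- The Jacobian entries are derivatives of the components of `ψ` inside `smoothOn U`; hence `D_J`
is the commutation of derivations, and `D_map` is the chain rule. -/
lemma isIsometry_pullback {g g' : Fin n → Fin n → EuclideanSpace ℝ (Fin n) → ℝ}
    (hg : IsMetricOn U g) (hg' : IsMetricOn V g')
    {ψ : EuclideanSpace ℝ (Fin n) → EuclideanSpace ℝ (Fin n)}
    (hψ : ContDiffOn ℝ ∞ ψ U) (hm : Set.MapsTo ψ U V)
    (h : ∀ y ∈ U, ∀ i j, g i j y = ∑ a, ∑ b, pd i (fun z => ψ z a) y * pd j (fun z => ψ z b) y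
      * g' a b (ψ y)) :
    ∃ J, hg.calculus.IsIsometry hg'.calculus (pullback hψ hm) J := by
  have hc : ∀ a, ContDiffOn ℝ ∞ (fun z => ψ z a) U := fun a =>
    (EuclideanSpace.proj a : EuclideanSpace ℝ (Fin n) →L[ℝ] ℝ).contDiff.comp_contDiffOn hψ
  have hJ : ∀ a i, Rep (hg.calculus.D i (smoothOn.res _ (hc a))) (pd i fun z => ψ z a) :=
    fun a i => hg.rep_D (Rep.res (hc a)) i
  refine ⟨Matrix.of fun a i => hg.calculus.D i (smoothOn.res _ (hc a)), fun i x => ?_,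
    fun i j a => hg.calculus.D_comm i j _, ?_⟩
  · have hx := Rep.extendZero x
    refine (hg.rep_D (hx.pullback hψ hm) i).ext
      (Rep.sum fun a => (hJ a i).mul ((hg'.rep_D hx a).pullback hψ hm)) fun y hy => ?_
    exact pd_comp (differentiableAt_extendZero x ⟨ψ y, hm hy⟩)
      ((hψ.differentiableOn (by simp)).differentiableAt (U.2.mem_nhds hy)) i
  · ext1 i j
    have e : ((Matrix.of fun a i => hg.calculus.D i (smoothOn.res _ (hc a))).transpose
          * hg'.calculus.g.map (pullback hψ hm)
          * Matrix.of fun a i => hg.calculus.D i (smoothOn.res _ (hc a))) i j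
        = ∑ a, ∑ b, hg.calculus.D i (smoothOn.res _ (hc a)) * hg.calculus.D j (smoothOn.res _ (hc b))
          * pullback hψ hm (hg'.calculus.g a b) := by
      simp only [Matrix.mul_apply, Matrix.transpose_apply, Matrix.of_apply, Matrix.map_apply,
        Finset.sum_mul]
      rw [Finset.sum_comm]
      exact Finset.sum_congr rfl fun _ _ => Finset.sum_congr rfl fun _ _ => by ring
    rw [e]
    exact (hg.rep_g i j).ext (Rep.sum fun a => Rep.sum fun b => ((hJ a i).mul (hJ b j)).mul
      ((hg'.rep_g a b).pullback hψ hm)) fun y hy => h y hy i j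

end Pullback

section Invariance

variable {n : ℕ} {M : Type*} [TopologicalSpace M] [ChartedSpace (EuclideanSpace ℝ (Fin n)) M]
  [IsManifold (𝓡 n) ∞ M] [RiemannianBundle (fun x : M => TangentSpace (𝓡 n) x)]
  [IsContMDiffRiemannianBundle (𝓡 n) ∞ (EuclideanSpace ℝ (Fin n))
      (fun x : M => TangentSpace (𝓡 n) x)]
  {e e' : OpenPartialHomeomorph M (EuclideanSpace ℝ (Fin n))} {f : M → ℝ}

/-- The Laplacian and the norm of the gradient do not depend on the chart. -/
lemma laplacian_gradInner_transition (he : e ∈ IsManifold.maximalAtlas (𝓡 n) ∞ M)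
    (he' : e' ∈ IsManifold.maximalAtlas (𝓡 n) ∞ M) (hf : ContMDiff (𝓡 n) 𝓘(ℝ) ∞ f)
    {y : EuclideanSpace ℝ (Fin n)} (hy : y ∈ (e.symm.trans e').source) :
    laplacian (metricIn e) (f ∘ e.symm) y
        = laplacian (metricIn e') (f ∘ e'.symm) (e' (e.symm y)) ∧
      gradInner (metricIn e) (f ∘ e.symm) (f ∘ e.symm) y
        = gradInner (metricIn e') (f ∘ e'.symm) (f ∘ e'.symm) (e' (e.symm y)) := by
  let W : Opens (EuclideanSpace ℝ (Fin n)) :=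
    ⟨(e.symm.trans e').source, (e.symm.trans e').open_source⟩
  have hg : IsMetricOn W (metricIn e) := (isMetricOn_metricIn he).mono fun z hz => hz.1
  have hg' := isMetricOn_metricIn he'
  have hψ : ContDiffOn ℝ ∞ (e' ∘ e.symm) W := contDiffOn_transition he he'
  have hm : Set.MapsTo (e' ∘ e.symm) W (chartTarget e') := fun z hz => e'.map_source hz.2
  obtain ⟨J, H⟩ := isIsometry_pullback hg hg' hψ hm fun z hz i j => metricIn_transition he he' hz i j
  have hx : Rep (U := chartTarget e') (smoothOn.res _ (contDiffOn_comp_symm he' hf)) (f ∘ e'.symm) :=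
    Rep.res _
  have hx' : Rep (pullback hψ hm (smoothOn.res _ (contDiffOn_comp_symm he' hf))) (f ∘ e.symm) :=
    fun z => (hx.pullback hψ hm z).trans (congrArg f (e'.left_inv z.2.2))
  exact ⟨(hg.rep_laplacian hx').eq ((hg'.rep_laplacian hx).pullback hψ hm) (H.con_Hess_map _) hy,
    (hg.rep_gradInner hx' hx').eq ((hg'.rep_gradInner hx hx).pullback hψ hm)
      (H.con_gradient_map _ _) hy⟩

end Invariance

/-! ### The soliton identities in a single chart. -/

section ChartIdentities

variable {n : ℕ} {U : Opens (EuclideanSpace ℝ (Fin n))}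
  {g : Fin n → Fin n → EuclideanSpace ℝ (Fin n) → ℝ} {u : EuclideanSpace ℝ (Fin n) → ℝ} {μ : ℝ}

namespace IsMetricOn

lemma soliton_equation (hg : IsMetricOn U g) (hu : ContDiffOn ℝ ∞ u U) {c : ℝ}
    (hS : ∀ y ∈ U, ∀ i j, ricci g i j y + hess g u i j y = c * g i j y) (i j : Fin n) :
    hg.calculus.Ric i j + hg.calculus.Hess (smoothOn.res u hu) i j = c • hg.calculus.g i j :=
  ((hg.rep_Ric i j).add (hg.rep_Hess (Rep.res hu) i j)).ext ((hg.rep_g i j).smul c)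
    fun y hy => hS y hy i j

lemma sum_weyl_mul_ricciUp (hg : IsMetricOn U g) {y : EuclideanSpace ℝ (Fin n)} (hy : y ∈ U)
    (i k : Fin n) : ∑ j, ∑ l, weyl g i j k l y * ricciUp g j l y
      = ∑ j, ∑ l, riemann g i j k l y * ricciUp g j l y
        + 1 / (((n : ℝ) - 1) * ((n : ℝ) - 2)) * (scal g y * (g i k y * scal g y - ricci g i k y))
        - 1 / ((n : ℝ) - 2) * (ricci g i k y * scal g y - 2 * ricciSq g i k y
          + g i k y * ricciNormSq g y) := by
  have h := hg.calculus.sum_weyl_mul_RicUp i k (1 / (((n : ℝ) - 1) * ((n : ℝ) - 2)))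
    (1 / ((n : ℝ) - 2))
  have := Rep.eq (Rep.sum fun j => Rep.sum fun l => (((hg.rep_riem i j k l).add
      ((hg.rep_scalar.mul (((hg.rep_g i k).mul (hg.rep_g j l)).sub
        ((hg.rep_g i l).mul (hg.rep_g j k)))).smul _)).sub
      ((((((hg.rep_Ric i k).mul (hg.rep_g j l)).sub ((hg.rep_Ric i l).mul (hg.rep_g j k))).add
        ((hg.rep_Ric j l).mul (hg.rep_g i k))).sub ((hg.rep_Ric j k).mul (hg.rep_g i l))).smul _)).mul
      (hg.rep_RicUp j l))
    (((Rep.sum fun j => Rep.sum fun l => (hg.rep_riem i j k l).mul (hg.rep_RicUp j l)).add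
      ((hg.rep_scalar.mul (((hg.rep_g i k).mul hg.rep_scalar).sub (hg.rep_Ric i k))).smul _)).sub
      (((((hg.rep_Ric i k).mul hg.rep_scalar).sub (hg.rep_RicSq i k).two_mul).add
        ((hg.rep_g i k).mul hg.rep_RicNormSq)).smul _)) h hy
  rw [← this]
  refine Finset.sum_congr rfl fun j _ => Finset.sum_congr rfl fun l _ => ?_
  rw [weyl]; ring

end IsMetricOn

variable (hg : IsMetricOn U g) (hu : ContDiffOn ℝ ∞ u U)
  (hS : ∀ y ∈ U, ∀ i j, ricci g i j y + hess g u i j y = μ / (n : ℝ) * g i j y)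
  {y : EuclideanSpace ℝ (Fin n)} (hy : y ∈ U)

namespace IsMetricOn

include hg hu hS hy

lemma scal_add_laplacian (hn : 1 ≤ n) : scal g y + laplacian g u y = μ := by
  have h := MetricCalculus.scalar_add_con_Hess (hg.soliton_equation hu hS)
  rw [Fintype.card_fin, ← map_natCast (algebraMap ℝ (smoothOn U)) n] at h
  rw [(hg.rep_scalar.add (hg.rep_laplacian (Rep.res hu))).eq ((Rep.const _).smul _) h hy]
  have : (n : ℝ) ≠ 0 := by positivity
  field_simp

lemma pd_scal (i : Fin n) :
    pd i (scal g) y = 2 * ∑ j, ricci g i j y * grad g u j y :=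
  (hg.rep_D hg.rep_scalar i).eq (Rep.sum fun j => (hg.rep_Ric i j).mul
    (hg.rep_gradient (Rep.res hu) j)).two_mul
    (MetricCalculus.D_scalar (hg.soliton_equation hu hS) i) hy

lemma cov2_ricci_comm (i j k : Fin n) : cov2 g (ricci g) j i k y - cov2 g (ricci g) i j k y
    = ∑ s, riemann g i j k s y * grad g u s y :=
  ((hg.rep_cov2 hg.rep_Ric j i k).sub (hg.rep_cov2 hg.rep_Ric i j k)).eq
    (Rep.sum fun s => (hg.rep_riem i j k s).mul (hg.rep_gradient (Rep.res hu) s))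
    (MetricCalculus.cov2_Ric_comm (hg.soliton_equation hu hS) i j k) hy

lemma laplacian_scal : laplacian g (scal g) y
    = gradInner g (scal g) u y + 2 * μ / (n : ℝ) * scal g y - 2 * ricciNormSq g y := by
  rw [(hg.rep_laplacian hg.rep_scalar).eq
    (((hg.rep_gradInner hg.rep_scalar (Rep.res hu)).add (hg.rep_scalar.smul _)).sub
      hg.rep_RicNormSq.two_mul)
    (MetricCalculus.con_Hess_scalar (hg.soliton_equation hu hS)) hy]
  ring

lemma laplacian2_ricci (i j : Fin n) : laplacian2 g (ricci g) i j y
    = gradInner2 g (ricci g) u i j y + 2 * μ / (n : ℝ) * ricci g i j y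
      - 2 * ∑ k, ∑ s, riemann g i k j s y * ricciUp g k s y := by
  rw [(hg.rep_laplacian_Ric i j).eq
    (((hg.rep_gradInner_Ric (Rep.res hu) i j).add ((hg.rep_Ric i j).smul _)).sub
      (Rep.sum fun k => Rep.sum fun s => (hg.rep_riem i k j s).mul (hg.rep_RicUp k s)).two_mul)
    (MetricCalculus.laplacian_Ric (hg.soliton_equation hu hS) i j) hy]
  ring

omit hu hS in
lemma ricciSqTrace_eq : ricciSqTrace g y = ricciNormSq g y :=
  hg.rep_con_RicSq.eq hg.rep_RicNormSq hg.calculus.con_RicSq hy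

lemma laplacian2_ricci_weyl (hn : 3 ≤ n) (i k : Fin n) : laplacian2 g (ricci g) i k y
    = gradInner2 g (ricci g) u i k y + 2 * μ / (n : ℝ) * ricci g i k y
      - 2 * ∑ j, ∑ l, weyl g i j k l y * ricciUp g j l y
      + 2 / (((n : ℝ) - 1) * ((n : ℝ) - 2)) * (scal g y ^ 2 * g i k y
        - (n : ℝ) * scal g y * ricci g i k y + 2 * ((n : ℝ) - 1) * ricciSq g i k y
        - ((n : ℝ) - 1) * ricciSqTrace g y * g i k y) := by
  have h3 : (3 : ℝ) ≤ n := by exact_mod_cast hn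
  have h1 : (n : ℝ) - 1 ≠ 0 := by linarith
  have h2 : (n : ℝ) - 2 ≠ 0 := by linarith
  rw [hg.laplacian2_ricci hu hS hy, hg.sum_weyl_mul_ricciUp hy, hg.ricciSqTrace_eq hy]
  field_simp
  ring

lemma pd_hamilton (i : Fin n) :
    pd i (fun z => scal g z + gradInner g u u z - 2 * (μ / (n : ℝ)) * u z) y = 0 :=
  (hg.rep_D ((hg.rep_scalar.add (hg.rep_gradInner (Rep.res hu) (Rep.res hu))).sub
    ((Rep.res hu).smul _)) i).eq (x' := 0) (u' := fun _ => 0) (fun _ => rfl)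
    (hg.calculus.D_hamilton (hg.soliton_equation hu hS) i) hy

omit hS hy in
lemma contDiffOn_hamilton (c : ℝ) :
    ContDiffOn ℝ ∞ (fun z => scal g z + gradInner g u u z - c * u z) U :=
  Rep.contDiffOn ((hg.rep_scalar.add (hg.rep_gradInner (Rep.res hu) (Rep.res hu))).sub
    ((Rep.res hu).smul c))

end IsMetricOn

end ChartIdentities

lemma fderiv_eq_zero_of_pd {n : ℕ} {u : EuclideanSpace ℝ (Fin n) → ℝ}
    {y : EuclideanSpace ℝ (Fin n)} (h : ∀ i, pd i u y = 0) : fderiv ℝ u y = 0 := by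
  ext v
  rw [euclidean_eq_sum v, map_sum]
  simp only [map_smul]
  exact Finset.sum_eq_zero fun i _ => by rw [show fderiv ℝ u y _ = 0 from h i, smul_zero]

/-! ### Hamilton's quantity as a function on the manifold. -/

section Hamilton

variable {n : ℕ} {M : Type*} [EMetricSpace M] [ChartedSpace (EuclideanSpace ℝ (Fin n)) M]
  [IsManifold (𝓡 n) ∞ M] [RiemannianBundle (fun x : M => TangentSpace (𝓡 n) x)]
  [IsContMDiffRiemannianBundle (𝓡 n) ∞ (EuclideanSpace ℝ (Fin n))
      (fun x : M => TangentSpace (𝓡 n) x)]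
  [IsRiemannianManifold (𝓡 n) M] {f : M → ℝ} {μ : ℝ}

/-- The quantity `R + |∇f|² - (2μ/n) f` read in the chart `e`. -/
def hamiltonIn (f : M → ℝ) (μ : ℝ) (e : OpenPartialHomeomorph M (EuclideanSpace ℝ (Fin n)))
    (y : EuclideanSpace ℝ (Fin n)) : ℝ :=
  scal (metricIn e) y + gradInner (metricIn e) (f ∘ e.symm) (f ∘ e.symm) y
    - 2 * (μ / (n : ℝ)) * (f ∘ e.symm) y

/-- The function `R + |∇f|² - (2μ/n) f` on the manifold. -/
def hamilton (n : ℕ) {M : Type*} [EMetricSpace M] [ChartedSpace (EuclideanSpace ℝ (Fin n)) M]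
    [RiemannianBundle (fun x : M => TangentSpace (𝓡 n) x)] (f : M → ℝ) (μ : ℝ) (x : M) : ℝ :=
  hamiltonIn f μ (chartAt (EuclideanSpace ℝ (Fin n)) x) (chartAt (EuclideanSpace ℝ (Fin n)) x x)

namespace IsGradientRicciSoliton

variable {e e' : OpenPartialHomeomorph M (EuclideanSpace ℝ (Fin n))}

/-- The trace identity in both charts replaces R by `μ` minus the Laplacian of `f`, so no
transformation law for the curvature is required. -/
lemma hamiltonIn_transition (hsol : IsGradientRicciSoliton n M f μ) (hn : 1 ≤ n)
    (he : e ∈ IsManifold.maximalAtlas (𝓡 n) ∞ M)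
    (he' : e' ∈ IsManifold.maximalAtlas (𝓡 n) ∞ M)
    {y : EuclideanSpace ℝ (Fin n)} (hy : y ∈ (e.symm.trans e').source) :
    hamiltonIn f μ e y = hamiltonIn f μ e' (e' (e.symm y)) := by
  have hm : e' (e.symm y) ∈ e'.target := e'.map_source hy.2
  have h1 := (isMetricOn_metricIn he).scal_add_laplacian (contDiffOn_comp_symm he hsol.smooth)
    (hsol.equation e he) hy.1 hn
  have h2 := (isMetricOn_metricIn he').scal_add_laplacian (contDiffOn_comp_symm he' hsol.smooth)
    (hsol.equation e' he') hm hn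
  obtain ⟨h3, h4⟩ := laplacian_gradInner_transition he he' hsol.smooth hy
  have h5 : (f ∘ e'.symm) (e' (e.symm y)) = (f ∘ e.symm) y := congrArg f (e'.left_inv hy.2)
  rw [hamiltonIn, hamiltonIn, h4, h5]
  linarith

lemma hamiltonIn_eq (hsol : IsGradientRicciSoliton n M f μ) (hn : 1 ≤ n)
    (he : e ∈ IsManifold.maximalAtlas (𝓡 n) ∞ M) {y : EuclideanSpace ℝ (Fin n)}
    (hy : y ∈ e.target) : hamiltonIn f μ e y = hamilton n f μ (e.symm y) :=
  hsol.hamiltonIn_transition hn he (IsManifold.chart_mem_maximalAtlas _)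
    ⟨hy, mem_chart_source _ (e.symm y)⟩

lemma isLocallyConstant_hamilton (hsol : IsGradientRicciSoliton n M f μ) (hn : 1 ≤ n) :
    IsLocallyConstant (hamilton n f μ) := by
  rw [IsLocallyConstant.iff_eventually_eq]
  intro x
  set e := chartAt (EuclideanSpace ℝ (Fin n)) x
  have he : e ∈ IsManifold.maximalAtlas (𝓡 n) ∞ M := IsManifold.chart_mem_maximalAtlas x
  have hx : x ∈ e.source := mem_chart_source _ x
  have hg := isMetricOn_metricIn he
  have hu := contDiffOn_comp_symm he hsol.smooth
  -- Where the derivative vanishes on an open set, level sets are open in it; this gives a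
  -- neighbourhood of `e x` without choosing a ball.
  have hopen := e.open_target.isOpen_inter_preimage_of_fderiv_eq_zero (f := hamiltonIn f μ e)
    ((hg.contDiffOn_hamilton hu _).differentiableOn (by simp))
    (fun y hy => fderiv_eq_zero_of_pd fun i => hg.pd_hamilton hu (hsol.equation e he) hy i)
    {hamiltonIn f μ e (e x)}
  have hnhds := (e.continuousAt hx).preimage_mem_nhds
    (hopen.mem_nhds ⟨e.map_source hx, rfl⟩)
  filter_upwards [hnhds, e.open_source.mem_nhds hx] with z hz hzs
  have h1 := hsol.hamiltonIn_eq hn he (e.map_source hzs)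
  have h2 := hsol.hamiltonIn_eq hn he (e.map_source hx)
  rw [e.left_inv hzs] at h1
  rw [e.left_inv hx] at h2
  rw [← h1, ← h2]
  exact hz.2

end IsGradientRicciSoliton

end Hamilton

end RicciSoliton

end

theorem mainTheorem8 (n : ℕ) (hn : 1 ≤ n) (M : Type*) [EMetricSpace M]
    [ChartedSpace (EuclideanSpace ℝ (Fin n)) M] [IsManifold (𝓡 n) ∞ M]
    [RiemannianBundle (fun x : M => TangentSpace (𝓡 n) x)]
    [IsContMDiffRiemannianBundle (𝓡 n) ∞ (EuclideanSpace ℝ (Fin n))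
      (fun x : M => TangentSpace (𝓡 n) x)]
    [IsRiemannianManifold (𝓡 n) M] (f : M → ℝ) (μ : ℝ)
    (hsol : RicciSoliton.IsGradientRicciSoliton n M f μ) :
    -- the identities between tensors, in every smooth chart `e`, with `u` the potential read in `e`
    (∀ e ∈ IsManifold.maximalAtlas (𝓡 n) ∞ M, ∀ y ∈ e.target,
      let g : Fin n → Fin n → EuclideanSpace ℝ (Fin n) → ℝ := RicciSoliton.metricIn e
      let u : EuclideanSpace ℝ (Fin n) → ℝ := f ∘ e.symm
      -- `R + Δf = μ`
      (RicciSoliton.scal g y + RicciSoliton.laplacian g u y = μ) ∧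
      -- `∇ᵢ R = 2 R_{ij} ∇^j f`
      (∀ i, RicciSoliton.pd i (RicciSoliton.scal g) y
        = 2 * ∑ j, RicciSoliton.ricci g i j y * RicciSoliton.grad g u j y) ∧
      -- `∇ⱼ R_{ik} - ∇ᵢ R_{jk} = R_{ijks} ∇^s f`
      (∀ i j k, RicciSoliton.cov2 g (RicciSoliton.ricci g) j i k y
          - RicciSoliton.cov2 g (RicciSoliton.ricci g) i j k y
        = ∑ s, RicciSoliton.riemann g i j k s y * RicciSoliton.grad g u s y) ∧
      -- `ΔR = ⟨∇R, ∇f⟩ + (2μ/n) R - 2 |Ric|²`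
      (RicciSoliton.laplacian g (RicciSoliton.scal g) y
        = RicciSoliton.gradInner g (RicciSoliton.scal g) u y
          + 2 * μ / (n : ℝ) * RicciSoliton.scal g y - 2 * RicciSoliton.ricciNormSq g y) ∧
      -- `ΔR_{ij} = ⟨∇R_{ij}, ∇f⟩ + (2μ/n) R_{ij} - 2 R_{ikjs} R^{ks}`
      (∀ i j, RicciSoliton.laplacian2 g (RicciSoliton.ricci g) i j y
        = RicciSoliton.gradInner2 g (RicciSoliton.ricci g) u i j y
          + 2 * μ / (n : ℝ) * RicciSoliton.ricci g i j y
          - 2 * ∑ k, ∑ s, RicciSoliton.riemann g i k j s y * RicciSoliton.ricciUp g k s y) ∧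
      -- the version with the Weyl tensor, in dimension at least three
      (3 ≤ n → ∀ i k, RicciSoliton.laplacian2 g (RicciSoliton.ricci g) i k y
        = RicciSoliton.gradInner2 g (RicciSoliton.ricci g) u i k y
          + 2 * μ / (n : ℝ) * RicciSoliton.ricci g i k y
          - 2 * ∑ j, ∑ l, RicciSoliton.weyl g i j k l y * RicciSoliton.ricciUp g j l y
          + 2 / (((n : ℝ) - 1) * ((n : ℝ) - 2))
            * (RicciSoliton.scal g y ^ 2 * g i k y
              - (n : ℝ) * RicciSoliton.scal g y * RicciSoliton.ricci g i k y
              + 2 * ((n : ℝ) - 1) * RicciSoliton.ricciSq g i k y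
              - ((n : ℝ) - 1) * RicciSoliton.ricciSqTrace g y * g i k y)) ∧
      -- `S = tr S_{ik} = |Ric|²`
      (RicciSoliton.ricciSqTrace g y = RicciSoliton.ricciNormSq g y)) ∧
    -- `R + |∇f|² - (2μ/n) f` is constant on every connected component of `M`
    (∃ C : ConnectedComponents M → ℝ,
      ∀ e ∈ IsManifold.maximalAtlas (𝓡 n) ∞ M, ∀ y ∈ e.target,
        RicciSoliton.scal (RicciSoliton.metricIn e) y
          + RicciSoliton.gradInner (RicciSoliton.metricIn e) (f ∘ e.symm) (f ∘ e.symm) y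
          - 2 * μ / (n : ℝ) * f (e.symm y) = C (e.symm y)) := by
  refine ⟨fun e he y hy => ?_, ?_⟩
  · have hg := RicciSoliton.isMetricOn_metricIn he
    have hu := RicciSoliton.contDiffOn_comp_symm he hsol.smooth
    have hS := hsol.equation e he
    exact ⟨hg.scal_add_laplacian hu hS hy hn, hg.pd_scal hu hS hy, hg.cov2_ricci_comm hu hS hy,
      hg.laplacian_scal hu hS hy, hg.laplacian2_ricci hu hS hy,
      fun h3 => hg.laplacian2_ricci_weyl hu hS hy h3, hg.ricciSqTrace_eq hy⟩
  · have hsurj := ConnectedComponents.surjective_coe (α := M)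
    -- The constant of a component is the value at a chosen point of it; local constancy on the
    -- preconnected component makes the choice harmless.
    refine ⟨fun c => RicciSoliton.hamilton n f μ (Function.surjInv hsurj c), fun e he y hy => ?_⟩
    have h1 := hsol.hamiltonIn_eq hn he hy
    have h2 : RicciSoliton.hamilton n f μ (e.symm y) = RicciSoliton.hamilton n f μ
        (Function.surjInv hsurj (e.symm y : ConnectedComponents M)) := by
      refine (hsol.isLocallyConstant_hamilton hn).apply_eq_of_isPreconnected
        isPreconnected_connectedComponent mem_connectedComponent ?_
      rw [← ConnectedComponents.coe_eq_coe']
      exact Function.surjInv_eq hsurj _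
    beta_reduce
    rw [← h2, ← h1, RicciSoliton.hamiltonIn, mul_div_assoc]
    rfl
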